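/- **Conventions.** A tree is a partially ordered set in which the set of predecessors of each element is well-ordered; $\mathrm{ht}_T(x)$ denotes the order type of $\{y : y <_T x\}$, and $T_x = \{y \in T : x \le_T y\}$ with the induced order. A Suslin tree is a tree of height $\omega_1$ with no uncountable chains and no uncountable antichains. A tree of height $\omega_1$ is normal if it has a root, every element has at least two immediate successors, distinct elements of the same limit height have different sets of predecessors, and every element has elements above it at every greater height below $\omega_1$. The product $T_0 \otimes \cdots \otimes T_{n-1}$ is the tree of all $n$-tuples $(a_0,\dots,a_{n-1}) \in T_0 \times \cdots \times T_{n-1}$ whose entries have the same heights in their respective trees, ordered componentwise. A tree $T$ is free if for all $0 < n < \omega$ and all distinct $x_0,\dots,x_{n-1} \in T$ of the same height, the tree $T_{x_0} \otimes \cdots \otimes T_{x_{n-1}}$ is Suslin. For a tree $R$ and an ordinal $\kappa$, $\prod_{\omega,\kappa} R$ is the forcing poset of all functions $p$ from a countable subset $\mathrm{dom}(p)$ of $\kappa$ to $R$, ordered by $q \le p$ iff $\mathrm{dom}(p) \subseteq \mathrm{dom}(q)$ and $p(i) \le_R q(i)$ for all $i \in \mathrm{dom}(p)$. A forcing poset $P$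 is proper if for all sufficiently large regular cardinals $\theta$, for every countable elementary substructure $M \prec (H(\theta),\in)$ with $P \in M$ and every $p \in P \cap M$, there is an $(M,P)$-generic condition $q \le p$, that is, a $q \le p$ such that for every dense $D \subseteq P$ with $D \in M$, the set $D \cap M$ is predense below $q$. It is countably distributive if the intersection of any countably many dense open subsets of $P$ is dense. **Theorem.** Let $R$ be a normal free Suslin tree and let $\kappa$ be a non-zero ordinal. Then the forcing poset $\prod_{\omega,\kappa} R$ is proper and countably distributive. -/

import Mathlib

open scoped Ordinal Cardinal

universe u

/-! ### Trees -/

/-- A (set-theoretic) tree: a partial order in which the set of predecessors of every element is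
well-ordered. -/
class IsTree (T : Type u) [PartialOrder T] : Prop where
  isWellOrder_Iio : ∀ x : T, IsWellOrder (Set.Iio x) (· < ·)

attribute [instance] IsTree.isWellOrder_Iio

namespace IsTree

variable {T : Type u} [PartialOrder T] [IsTree T]

/-- The height of an element: the order type of its set of predecessors. -/
noncomputable def height (x : T) : Ordinal.{u} :=
  Ordinal.type (fun a b : Set.Iio x => a < b)

theorem height_lt_height {x y : T} (h : x < y) : height x < height y := by
  refine Ordinal.type_lt_iff.2 ⟨⟨⟨⟨fun a => ⟨a.1, lt_trans a.2 h⟩, ?_⟩, ?_⟩, ⟨x, h⟩, ?_⟩⟩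
  · intro a b hab
    simpa [Subtype.ext_iff] using hab
  · intro a b
    rfl
  · intro b
    constructor
    · rintro ⟨a, rfl⟩
      exact a.2
    · intro hb
      exact ⟨⟨b.1, hb⟩, rfl⟩

theorem height_mono {x y : T} (h : x ≤ y) : height x ≤ height y := by
  rcases h.eq_or_lt with rfl | h
  · exact le_rfl
  · exact (height_lt_height h).le

/-- Elements below a common element are comparable. -/
theorem le_total_of_le {x y z : T} (hx : x ≤ z) (hy : y ≤ z) : x ≤ y ∨ y ≤ x := by
  rcases hx.eq_or_lt with rfl | hx
  · exact Or.inr hy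
  rcases hy.eq_or_lt with rfl | hy
  · exact Or.inl hx.le
  rcases trichotomous_of (fun a b : Set.Iio z => a < b) ⟨x, hx⟩ ⟨y, hy⟩ with h | h | h
  · exact Or.inl (le_of_lt h)
  · exact Or.inl (le_of_eq (congrArg Subtype.val h))
  · exact Or.inr (le_of_lt h)

theorem le_of_le_of_height_le {x y z : T} (hx : x ≤ z) (hy : y ≤ z)
    (h : height x ≤ height y) : x ≤ y := by
  rcases le_total_of_le hx hy with h' | h'
  · exact h'
  · rcases h'.eq_or_lt with rfl | h'
    · exact le_rfl
    · exact absurd (height_lt_height h') (not_lt.2 h)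

/-- Criterion for being a tree: elements below a common element are comparable and the strict
order maps strictly monotonically to the ordinals. -/
theorem of_height {S : Type u} [PartialOrder S] (ht : S → Ordinal.{u})
    (hlt : ∀ a b : S, a < b → ht a < ht b)
    (hcomp : ∀ a b c : S, a ≤ c → b ≤ c → a ≤ b ∨ b ≤ a) : IsTree S where
  isWellOrder_Iio c :=
    { trichotomous := by
        intro a b hab hba
        rcases hcomp a.1 b.1 c (le_of_lt a.2) (le_of_lt b.2) with h | h
        · rcases h.eq_or_lt with h | h
          · exact Subtype.ext h
          · exact absurd h hab
        · rcases h.eq_or_lt with h | h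
          · exact Subtype.ext h.symm
          · exact absurd h hba
      wf := Subrelation.wf (fun {a b} hab => hlt a.1 b.1 hab)
        (InvImage.wf (fun a : Set.Iio c => ht a.1) Ordinal.lt_wf) }

end IsTree

open IsTree

/-- The part `T_x = {y : x ≤ y}` of the tree above `x`, with the induced order. -/
abbrev TreeAbove {T : Type u} [PartialOrder T] (x : T) : Type u := {y : T // x ≤ y}

instance {T : Type u} [PartialOrder T] [IsTree T] (x : T) : IsTree (TreeAbove x) :=
  IsTree.of_height (fun y => height y.1) (fun _ _ h => height_lt_height h)
    (fun _ _ _ hac hbc => le_total_of_le (T := T) hac hbc)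

/-- The tree product `T_0 ⊗ ⋯ ⊗ T_{n-1}`: all tuples whose entries have the same height in their
respective trees, ordered componentwise. -/
abbrev TreeTensor {n : ℕ} (T : Fin n → Type u) [∀ i, PartialOrder (T i)] [∀ i, IsTree (T i)] :
    Type u :=
  {a : (i : Fin n) → T i // ∀ i j, height (a i) = height (a j)}

instance {n : ℕ} (T : Fin n → Type u) [∀ i, PartialOrder (T i)] [∀ i, IsTree (T i)] :
    IsTree (TreeTensor T) := by
  rcases Nat.eq_zero_or_pos n with rfl | hn
  · exact IsTree.of_height (fun _ => 0)
      (fun a b h => absurd (Subtype.ext (funext fun i => i.elim0)) h.ne)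
      (fun a b _ _ _ => Or.inl fun i => i.elim0)
  · let i₀ : Fin n := ⟨0, hn⟩
    refine IsTree.of_height (fun a => height (a.1 i₀)) ?_ ?_
    · intro a b hab
      obtain ⟨hle, i, hi⟩ := Pi.lt_def.1 (show a.1 < b.1 from hab)
      rw [a.2 i₀ i, b.2 i₀ i]
      exact height_lt_height hi
    · intro a b c hac hbc
      rcases le_total (height (a.1 i₀)) (height (b.1 i₀)) with h | h
      · refine Or.inl fun i => le_of_le_of_height_le (hac i) (hbc i) ?_
        rwa [a.2 i i₀, b.2 i i₀]
      · refine Or.inr fun i => le_of_le_of_height_le (hbc i) (hac i) ?_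
        rwa [a.2 i i₀, b.2 i i₀]

/-- A Suslin tree: a tree of height `ω₁` with no uncountable chains and no uncountable
antichains. -/
structure IsSuslin (T : Type u) [PartialOrder T] [IsTree T] : Prop where
  height_lt : ∀ x : T, height x < ω₁
  exists_height_eq : ∀ α : Ordinal.{u}, α < ω₁ → ∃ x : T, height x = α
  countable_of_isChain : ∀ C : Set T, IsChain (· ≤ ·) C → C.Countable
  countable_of_isAntichain : ∀ A : Set T, IsAntichain (· ≤ ·) A → A.Countable

/-- A normal tree (of height `ω₁`). -/
structure IsNormalTree (T : Type u) [PartialOrder T] [IsTree T] : Prop where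
  exists_root : ∃ r : T, ∀ x, r ≤ x
  exists_two_immediate_successors : ∀ x : T, ∃ y z : T, y ≠ z ∧ x ⋖ y ∧ x ⋖ z
  eq_of_limit_height : ∀ x y : T, height x = height y → Order.IsSuccLimit (height x) →
    Set.Iio x = Set.Iio y → x = y
  exists_above : ∀ (x : T) (α : Ordinal.{u}), height x < α → α < ω₁ →
    ∃ y : T, x < y ∧ height y = α

/-- A tree is free if for every `n > 0` all its `n`-derived trees
`T_{x_0} ⊗ ⋯ ⊗ T_{x_{n-1}}`, with `x_0, …, x_{n-1}` distinct elements of the same height,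
are Suslin. -/
def IsFreeTree (T : Type u) [PartialOrder T] [IsTree T] : Prop :=
  ∀ (n : ℕ), 0 < n → ∀ x : Fin n → T, Function.Injective x →
    (∀ i j, height (x i) = height (x j)) → IsSuslin (TreeTensor fun i => TreeAbove (x i))

/-! ### The countable support product -/

/-- Conditions: partial functions from `ι` to `R` with countable domain (`none` means that the
index is outside the domain). -/
@[ext]
structure CountableSupportProduct (ι R : Type u) where
  toFun : ι → Option R
  countable_dom : {i | toFun i ≠ none}.Countable

/-- `q ≤ p` if `dom p ⊆ dom q` and `p i ≤ q i` in the tree for all `i ∈ dom p`: stronger conditions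
are smaller. -/
instance (ι R : Type u) [PartialOrder R] : PartialOrder (CountableSupportProduct ι R) where
  le q p := ∀ i x, p.toFun i = some x → ∃ y, q.toFun i = some y ∧ x ≤ y
  le_refl p i x h := ⟨x, h, le_rfl⟩
  le_trans r q p hrq hqp i x h := by
    obtain ⟨y, hy, hxy⟩ := hqp i x h
    obtain ⟨z, hz, hyz⟩ := hrq i y hy
    exact ⟨z, hz, hxy.trans hyz⟩
  le_antisymm p q hpq hqp := by
    apply CountableSupportProduct.ext
    funext i
    apply Option.ext
    intro x
    constructor
    · intro h
      obtain ⟨y, hy, hxy⟩ := hqp i x h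
      obtain ⟨z, hz, hyz⟩ := hpq i y hy
      obtain rfl : x = z := Option.some.inj (h.symm.trans hz)
      rwa [le_antisymm hxy hyz]
    · intro h
      obtain ⟨y, hy, hxy⟩ := hpq i x h
      obtain ⟨z, hz, hyz⟩ := hqp i y hy
      obtain rfl : x = z := Option.some.inj (h.symm.trans hz)
      rwa [le_antisymm hxy hyz]

/-! ### Forcing notions (stronger conditions are smaller) -/

section Forcing

variable {P : Type u} [Preorder P]

/-- Density in a forcing notion. -/
def ForcingDense (D : Set P) : Prop := ∀ p : P, ∃ q ∈ D, q ≤ p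

/-- Two conditions are compatible if they have a common extension. -/
def ForcingCompatible (p q : P) : Prop := ∃ r : P, r ≤ p ∧ r ≤ q

end Forcing

/-- The intersection of countably many dense open sets is dense (it is then dense open, since
openness is preserved by all intersections). -/
def IsCountablyDistributive (P : Type u) [Preorder P] : Prop :=
  ∀ D : ℕ → Set P, (∀ n, ForcingDense (D n) ∧ IsLowerSet (D n)) → ForcingDense (⋂ n, D n)

/-! ### `H(θ)` and its elementary substructures -/

/-- The relation symbols of the language of set theory: a single binary symbol. -/
inductive SetTheoryRel : ℕ → Type
  | mem : SetTheoryRel 2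

/-- The first-order language of set theory. -/
def setTheoryLanguage : FirstOrder.Language.{0, 0} := ⟨fun _ => Empty, SetTheoryRel⟩

/-- `H(θ)`: the sets whose transitive closure has cardinality less than `θ`, that is, those
contained in a transitive set of cardinality less than `θ`. -/
def HSet (θ : Cardinal.{u}) : Set ZFSet.{u} :=
  {x | ∃ t : ZFSet.{u}, t.IsTransitive ∧ x ⊆ t ∧ t.card < θ}

/-- `H(θ)` with the membership relation, as a structure for the language of set theory. -/
instance (θ : Cardinal.{u}) : setTheoryLanguage.Structure (HSet θ) where
  funMap f _ := f.elim
  RelMap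
    | SetTheoryRel.mem, v => (v 0 : ZFSet.{u}) ∈ (v 1 : ZFSet.{u})

/-- The sets that belong to `M`, for `M ≺ H(θ)`. -/
def elemsOf {θ : Cardinal.{u}} (M : setTheoryLanguage.ElementarySubstructure (HSet θ)) :
    Set ZFSet.{u} :=
  Subtype.val '' (M : Set (HSet θ))

/-! ### Properness -/

section Proper

variable {P : Type u} [Preorder P]

/-- The set `{c p : p ∈ D}` which represents `D ⊆ P` when `p ∈ P` is represented by the
set `c p`. -/
noncomputable def codeSet (c : P → ZFSet.{u}) (D : Set P) : ZFSet.{u} :=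
  ZFSet.range (fun p : D => c p)

/-- The set representing the forcing notion `(P, ≤)` when `p ∈ P` is represented by `c p`: the
ordered pair of the underlying set and the order relation as a set of ordered pairs. -/
noncomputable def codeForcing (c : P → ZFSet.{u}) : ZFSet.{u} :=
  ZFSet.pair (codeSet c Set.univ)
    (ZFSet.range fun pq : {pq : P × P // pq.1 ≤ pq.2} => ZFSet.pair (c pq.1.1) (c pq.1.2))

/-- `q` is `(N, P)`-generic: for every dense `D ⊆ P` that belongs to `N`, the set `D ∩ N` is
predense below `q`. -/
def IsGenericCondition (c : P → ZFSet.{u}) (N : Set ZFSet.{u}) (q : P) : Prop :=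
  ∀ D : Set P, ForcingDense D → codeSet c D ∈ N →
    ∀ r ≤ q, ∃ s ∈ D, c s ∈ N ∧ ForcingCompatible r s

end Proper

/-- A forcing notion `P` is proper if for all large enough regular `θ`, all countable `M ≺ H(θ)`
with `P ∈ M` and all `p ∈ P ∩ M` there is an `(M, P)`-generic condition `q ≤ p`. As the elements of
`P` need not be sets in the sense of `ZFSet`, we ask for this whenever the elements of `P` are
identified with sets by means of an injection `c`, so the notion does not depend on the choice
of `c`. -/
def IsProperForcing (P : Type u) [Preorder P] : Prop :=
  ∀ c : P → ZFSet.{u}, Function.Injective c →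
    ∃ θ₀ : Cardinal.{u}, ∀ θ : Cardinal.{u}, θ₀ ≤ θ → θ.IsRegular →
      ∀ M : setTheoryLanguage.ElementarySubstructure (HSet θ),
        (elemsOf M).Countable → codeForcing c ∈ elemsOf M →
          ∀ p : P, c p ∈ elemsOf M → ∃ q ≤ p, IsGenericCondition c (elemsOf M) q

/-! Both conclusions come from one construction. Let S be a countable set of conditions closed under
suitable operations, and let δ be the supremum of the ranks of its members, a countable limit
ordinal. A descending sequence in S is built that meets the given dense sets inside S. A Suslin tree
is not σ-closed, so a lower bound must be prepared along the way: at each stage finitely many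
indices i carry promised values x(i), distinct elements of level δ, and the current condition stays
below the promise. Every index that enters a domain receives a promise eventually, and the promises
form the lower bound.

Freeness is what allows an extension into a dense set D that respects the promise. By normality the
finitely many x(i) have distinct restrictions a(i) to some level below δ. In the derived tree above
the a(i), the tuples that bound the values of some extension in D form a dense set closed upwards. A
maximal antichain inside it is countable, so all tuples of large enough height belong to it
(`IsFreeTree.exists_forall_height_ge_mem`). This includes a restriction of x, although x itself is
not determined by S. Levels of R are countable, so countably many witnesses suffice and S can be
closed under choosing them. `exists_extension_mem` is the single step and `exists_le_forall_dense`
the fusion.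

For distributivity, S is the closure of one condition. For properness, S is the set of conditions in
M. The closure operations are coded by a set W in H(θ) that need not lie in M. However, that
countable sets closed under W have generic extensions is a first-order property of W with parameters
in M, so some W' in M has it, and M is closed under W' (`isProperForcing_of_closure_operations`). -/

/-! ### Restrictions and levels of trees -/

namespace IsTree

variable {T : Type u} [PartialOrder T] [IsTree T]

theorem height_coe_Iio {x : T} (y : Set.Iio x) :
    height y.1 = Ordinal.typein (fun a b : Set.Iio x => a < b) y := by
  rw [← Ordinal.type_subrel]
  refine Ordinal.type_eq.2 ⟨⟨⟨fun a => ⟨⟨a.1, lt_trans a.2 y.2⟩, a.2⟩, fun a => ⟨a.1.1, a.2⟩,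
    fun _ => rfl, fun _ => rfl⟩, ?_⟩⟩
  intro a b
  rfl

theorem exists_le_height_eq {x : T} {α : Ordinal.{u}} (h : α ≤ height x) :
    ∃ y ≤ x, height y = α := by
  rcases h.eq_or_lt with rfl | h
  · exact ⟨x, le_rfl, rfl⟩
  · obtain ⟨y, hy⟩ := Ordinal.typein_surj (fun a b : Set.Iio x => a < b) h
    exact ⟨y.1, le_of_lt y.2, (height_coe_Iio y).trans hy⟩

theorem eq_of_le_of_le {x y z : T} (hx : x ≤ z) (hy : y ≤ z) (h : height x = height y) :
    x = y :=
  le_antisymm (le_of_le_of_height_le hx hy h.le) (le_of_le_of_height_le hy hx h.ge)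

theorem eq_of_le_of_height_le {x y : T} (hxy : x ≤ y) (h : height y ≤ height x) : x = y := by
  rcases hxy.eq_or_lt with rfl | hlt
  · rfl
  · exact absurd (height_lt_height hlt) (not_lt.2 h)

theorem height_covBy {x y : T} (h : x ⋖ y) : height y = height x + 1 := by
  have h1 : height x + 1 ≤ height y := Order.add_one_le_of_lt (height_lt_height h.lt)
  obtain ⟨z, hz, hzh⟩ := exists_le_height_eq h1
  have hxz : x ≤ z := le_of_le_of_height_le h.le hz (by rw [hzh]; exact le_self_add)
  have hlt : x < z := lt_of_le_of_ne hxz (by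
    rintro rfl
    exact (Order.lt_add_one_iff.2 le_rfl).ne hzh)
  have : z = y := by
    by_contra hne
    exact h.2 hlt (lt_of_le_of_ne hz hne)
  rw [← this, hzh]

theorem isAntichain_level (α : Ordinal.{u}) : IsAntichain (· ≤ ·) {x : T | height x = α} := by
  intro x hx y hy hne hle
  exact hne (eq_of_le_of_height_le hle (by rw [hx, hy]))

/-- The predecessors of y split into those below x, followed by those in the cone above x. Left
cancellation then makes equality of heights in cones over one level the same as equality of heights
in the whole tree. -/
theorem height_eq_add_height_treeAbove (x : T) (y : TreeAbove x) :
    height y.1 = height x + height y := by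
  unfold height
  rw [← Ordinal.type_sum_lex]
  have hx (a : T) (h : a < x) : a < y.1 := lt_of_lt_of_le h y.2
  let f : Set.Iio x ⊕ Set.Iio y → Set.Iio y.1 :=
    Sum.elim (fun a => ⟨a.1, hx a.1 a.2⟩) (fun b => ⟨b.1.1, b.2⟩)
  have hlt : ∀ (a : Set.Iio x) (b : Set.Iio y), a.1 < b.1.1 := fun a b => lt_of_lt_of_le a.2 b.1.2
  have hmap : ∀ a b, Sum.Lex (fun a b : Set.Iio x => a < b) (fun a b : Set.Iio y => a < b) a b →
      f a < f b := by
    rintro _ _ (h | h | _)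
    · exact h
    · exact h
    · exact hlt _ _
  refine Eq.symm (Ordinal.type_eq.2 ⟨⟨Equiv.ofBijective f ⟨?_, ?_⟩, ?_⟩⟩)
  · rintro (a | a) (b | b) h
    · exact congrArg Sum.inl (Subtype.ext (Subtype.mk.inj h))
    · exact absurd (congrArg Subtype.val h) (hlt a b).ne
    · exact absurd (congrArg Subtype.val h).symm (hlt b a).ne
    · exact congrArg Sum.inr (Subtype.ext (Subtype.ext (Subtype.mk.inj h)))
  · intro b
    by_cases hb : x ≤ b.1
    · exact ⟨Sum.inr ⟨⟨b.1, hb⟩, b.2⟩, rfl⟩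
    · have : b.1 < x := by
        rcases le_total_of_le y.2 (le_of_lt b.2) with h | h
        · exact absurd h hb
        · exact lt_of_le_not_ge h hb
      exact ⟨Sum.inl ⟨b.1, this⟩, rfl⟩
  · intro a b
    refine ⟨fun h => ?_, hmap a b⟩
    rcases trichotomous_of (Sum.Lex (fun a b : Set.Iio x => a < b) (fun a b : Set.Iio y => a < b))
      a b with h' | h' | h'
    · exact h'
    · subst h'
      exact absurd h (lt_irrefl (f a))
    · exact absurd h (lt_asymm (hmap _ _ h'))

theorem height_treeAbove_eq_iff {x x' : T} (hx : height x = height x') (y : TreeAbove x)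
    (y' : TreeAbove x') : height y = height y' ↔ height y.1 = height y'.1 := by
  rw [height_eq_add_height_treeAbove, height_eq_add_height_treeAbove, hx]
  exact (add_right_injective _).eq_iff.symm

end IsTree

/-! ### Countable levels and consequences of normality. -/

theorem add_one_lt_omega_one {α : Ordinal.{u}} (h : α < ω₁) : α + 1 < ω₁ :=
  (Cardinal.isSuccLimit_omega 1).add_one_lt h

theorem IsSuslin.countable_level {T : Type u} [PartialOrder T] [IsTree T] (h : IsSuslin T)
    (α : Ordinal.{u}) : {x : T | height x = α}.Countable :=
  h.countable_of_isAntichain _ (isAntichain_level α)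

namespace IsNormalTree

variable {T : Type u} [PartialOrder T] [IsTree T]

theorem exists_ge_height_eq (hT : IsNormalTree T) (x : T) {α : Ordinal.{u}} (h : height x ≤ α)
    (hα : α < ω₁) : ∃ y, x ≤ y ∧ height y = α := by
  rcases h.eq_or_lt with h | h
  · exact ⟨x, le_rfl, h⟩
  · obtain ⟨y, hy, hy'⟩ := hT.exists_above x α h hα
    exact ⟨y, hy.le, hy'⟩

/-- Distinct elements of the same limit height have distinct restrictions to all large enough
levels. -/
theorem exists_lt_forall_restrict_ne (hT : IsNormalTree T) {x y : T} (hxy : x ≠ y)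
    (h : height x = height y) (hl : Order.IsSuccLimit (height x)) :
    ∃ γ < height x, ∀ a b, a ≤ x → b ≤ y → γ ≤ height a → a ≠ b := by
  by_contra! H
  refine hxy (hT.eq_of_limit_height x y h hl (Set.ext fun z => ?_))
  constructor
  · intro hz
    obtain ⟨a, b, ha, hb, hza, rfl⟩ := H (height z) (height_lt_height hz)
    refine lt_of_le_of_ne ((le_of_le_of_height_le hz.le ha hza).trans hb) ?_
    rintro rfl
    exact (height_lt_height hz).ne h.symm
  · intro hz
    obtain ⟨a, b, ha, hb, hza, rfl⟩ := H (height z) (h ▸ height_lt_height hz)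
    refine lt_of_le_of_ne ((le_of_le_of_height_le hz.le hb hza).trans ha) ?_
    rintro rfl
    exact (height_lt_height hz).ne h

/-- The elements of E are avoided one at a time: two immediate successors of y have the same height,
so at most one of them is below e, and the limit δ leaves room for the extra step. -/
theorem exists_ge_height_lt_not_le (hT : IsNormalTree T) {δ : Ordinal.{u}}
    (hδ : Order.IsSuccLimit δ) (E : Finset T) (x : T) (hx : height x < δ) :
    ∃ y, x ≤ y ∧ height y < δ ∧ ∀ e ∈ E, ¬ y ≤ e := by
  classical
  induction E using Finset.induction_on with
  | empty => exact ⟨x, le_rfl, hx, by simp⟩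
  | insert e E _ ih =>
    obtain ⟨y, hxy, hy, hE⟩ := ih
    obtain ⟨z, z', hne, hz, hz'⟩ := hT.exists_two_immediate_successors y
    have key : ∀ w, y ⋖ w → ¬ w ≤ e → ∃ y, x ≤ y ∧ height y < δ ∧ ∀ e' ∈ insert e E, ¬ y ≤ e' := by
      intro w hw hwe
      refine ⟨w, hxy.trans hw.le, ?_, ?_⟩
      · rw [height_covBy hw]
        exact hδ.add_one_lt hy
      · intro e' he'
        rcases Finset.mem_insert.1 he' with rfl | he'
        · exact hwe
        · exact fun h => hE e' he' (hw.le.trans h)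
    by_cases h : z ≤ e
    · refine key z' hz' fun h' => hne (eq_of_le_of_le h h' ?_)
      rw [height_covBy hz, height_covBy hz']
    · exact key z hz h

/-- Above every element of height below a limit level there is an element of that level which
avoids a given finite set. -/
theorem exists_ge_height_eq_notMem (hT : IsNormalTree T) {δ : Ordinal.{u}}
    (hδ : Order.IsSuccLimit δ) (hδ₁ : δ < ω₁) (E : Finset T) (x : T) (hx : height x < δ) :
    ∃ y, x ≤ y ∧ height y = δ ∧ y ∉ E := by
  obtain ⟨y, hxy, hy, hE⟩ := hT.exists_ge_height_lt_not_le hδ E x hx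
  obtain ⟨z, hyz, hz⟩ := hT.exists_ge_height_eq y hy.le hδ₁
  exact ⟨z, hxy.trans hyz, hz, fun h => hE z h hyz⟩

end IsNormalTree

/-! ### Freeness: dense sets of tuples in derived trees. -/

/-- In a free tree, a dense set of tuples above `a` that is closed upwards contains all tuples of
large enough height above `a`. -/
theorem IsFreeTree.exists_forall_height_ge_mem {R : Type u} [PartialOrder R] [IsTree R]
    (hFree : IsFreeTree R) (hR : IsSuslin R) {k : ℕ} (a : Fin k → R) (ha : Function.Injective a)
    (hah : ∀ i j, height (a i) = height (a j)) (U : Set (Fin k → R))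
    (hU : ∀ b ∈ U, ∀ b', b ≤ b' → b' ∈ U)
    (hdense : ∀ b, a ≤ b → (∀ i j, height (b i) = height (b j)) →
      ∃ b' ∈ U, b ≤ b' ∧ ∀ i j, height (b' i) = height (b' j)) :
    ∃ β < ω₁, ∀ b, a ≤ b → (∀ i j, height (b i) = height (b j)) → (∀ i, β ≤ height (b i)) →
      b ∈ U := by
  -- Freeness says nothing about empty tuples, but the fusion starts with no promised values and
  -- needs this case.
  rcases Nat.eq_zero_or_pos k with rfl | hk
  · refine ⟨0, Ordinal.omega_pos 1, fun b hab hb _ => ?_⟩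
    obtain ⟨b', hb', -⟩ := hdense b hab hb
    rwa [Subsingleton.elim b b']
  have hS := hFree k hk a ha hah
  let i₀ : Fin k := ⟨0, hk⟩
  let T := TreeTensor fun i => TreeAbove (a i)
  let val : T → Fin k → R := fun t i => (t.1 i).1
  have hval : ∀ t : T, ∀ i j, height (val t i) = height (val t j) := fun t i j =>
    (height_treeAbove_eq_iff (hah i j) _ _).1 (t.2 i j)
  let mk : ∀ b, a ≤ b → (∀ i j, height (b i) = height (b j)) → T := fun b hab hb =>
    ⟨fun i => ⟨b i, hab i⟩, fun i j => (height_treeAbove_eq_iff (hah i j) _ _).2 (hb i j)⟩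
  -- A is maximal among the antichains contained in U; density of U makes up for the restriction to
  -- U.
  obtain ⟨A, hA⟩ := zorn_subset {A : Set T | IsAntichain (· ≤ ·) A ∧ ∀ t ∈ A, val t ∈ U} (by
    intro c hc hchain
    refine ⟨⋃₀ c, ⟨?_, ?_⟩, fun s hs => Set.subset_sUnion_of_mem hs⟩
    · exact (Set.pairwise_sUnion hchain.directedOn).2 fun s hs => (hc hs).1
    · rintro t ⟨s, hs, ht⟩
      exact (hc hs).2 t ht)
  have hAc : A.Countable := hS.countable_of_isAntichain A hA.prop.1
  have : Countable A := hAc.to_subtype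
  refine ⟨⨆ t : A, height (val t.1 i₀), Ordinal.iSup_lt_omega_one fun t => hR.height_lt _,
    fun b hab hb hβ => ?_⟩
  obtain ⟨b', hb'U, hbb', hb'⟩ := hdense b hab hb
  have hab' := hab.trans hbb'
  obtain ⟨t, htA, hcomp⟩ : ∃ t ∈ A, t ≤ mk b' hab' hb' ∨ mk b' hab' hb' ≤ t := by
    by_contra! H
    have hmem : mk b' hab' hb' ∈ A := by
      refine hA.le_of_ge (y := insert (mk b' hab' hb') A) ⟨?_, ?_⟩ (Set.subset_insert _ _)
        (Set.mem_insert _ _)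
      · refine hA.prop.1.insert ?_ ?_
        · exact fun t ht _ => (H t ht).1
        · exact fun t ht _ => (H t ht).2
      · rintro t (rfl | ht)
        · exact hb'U
        · exact hA.prop.2 t ht
    exact (H _ hmem).1 le_rfl
  have hth : ∀ i, height (val t i) ≤ height (b i) := fun i => by
    rw [hval t i i₀]
    exact (Ordinal.le_iSup (fun t : A => height (val t.1 i₀)) ⟨t, htA⟩).trans (hβ i)
  -- Either t and b are both below b', and then t ≤ b by comparing heights, or b ≤ b' ≤ t with t no
  -- higher than b, which forces b = b'.
  rcases hcomp with h | h
  · exact hU _ (hA.prop.2 t htA) b fun i => le_of_le_of_height_le (h i) (hbb' i) (hth i)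
  · have : b = b' := funext fun i => eq_of_le_of_height_le (hbb' i)
      ((height_mono (show b' i ≤ val t i from h i)).trans (hth i))
    rwa [this]

/-! ### Conditions of the countable support product -/

namespace CountableSupportProduct

variable {ι R : Type u}

/-- The condition with domain `{i}` and value `r`. -/
noncomputable def single (i : ι) (r : R) : CountableSupportProduct ι R where
  toFun := Function.extend (fun _ : Unit => i) (fun _ => some r) (fun _ => none)
  countable_dom := (Set.countable_singleton i).mono fun j hj => by
    by_contra h
    exact hj (Function.extend_apply' _ _ _ (by rintro ⟨_, rfl⟩; exact h rfl))

theorem single_apply_self (i : ι) (r : R) : (single i r).toFun i = some r :=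
  Function.Injective.extend_apply (f := fun _ : Unit => i) (fun _ _ _ => rfl) (fun _ => some r)
    (fun _ => none) ()

/-- The condition obtained from `p` by changing the values at the indices `i j` to `a j`. -/
noncomputable def updateTuple {k : ℕ} (p : CountableSupportProduct ι R) (i : Fin k → ι)
    (a : Fin k → R) : CountableSupportProduct ι R where
  toFun := Function.extend i (fun j => some (a j)) p.toFun
  countable_dom := (p.countable_dom.union (Set.countable_range i)).mono fun l hl => by
    by_cases h : ∃ j, i j = l
    · exact Or.inr h
    · refine Or.inl ?_
      intro hn
      exact hl ((Function.extend_apply' _ _ _ h).trans hn)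

theorem updateTuple_apply {k : ℕ} (p : CountableSupportProduct ι R) {i : Fin k → ι}
    (hi : Function.Injective i) (a : Fin k → R) (j : Fin k) :
    (updateTuple p i a).toFun (i j) = some (a j) :=
  hi.extend_apply (fun j => some (a j)) p.toFun j

theorem countable_graph (p : CountableSupportProduct ι R) :
    {x : ι × R | p.toFun x.1 = some x.2}.Countable := by
  refine Set.MapsTo.countable_of_injOn (f := Prod.fst) (t := {i | p.toFun i ≠ none}) ?_ ?_
    p.countable_dom
  · intro x hx
    exact Option.ne_none_iff_exists'.2 ⟨x.2, hx⟩
  · rintro ⟨i, x⟩ hx ⟨j, y⟩ hy (rfl : i = j)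
    exact Prod.ext rfl (Option.some.inj (hx.symm.trans hy))

variable [PartialOrder R]

theorem updateTuple_le {k : ℕ} (p : CountableSupportProduct ι R) {i : Fin k → ι}
    (hi : Function.Injective i) (a : Fin k → R) (h : ∀ j x, p.toFun (i j) = some x → x ≤ a j) :
    updateTuple p i a ≤ p := by
  intro l x hx
  by_cases hl : ∃ j, i j = l
  · obtain ⟨j, rfl⟩ := hl
    exact ⟨a j, updateTuple_apply p hi a j, h j x hx⟩
  · exact ⟨x, (Function.extend_apply' (fun j => some (a j)) p.toFun l hl).trans hx, le_rfl⟩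

theorem ne_none_of_le {p q : CountableSupportProduct ι R} (h : q ≤ p) {i : ι}
    (hi : p.toFun i ≠ none) : q.toFun i ≠ none := by
  obtain ⟨x, hx⟩ := Option.ne_none_iff_exists'.1 hi
  obtain ⟨y, hy, -⟩ := h i x hx
  simp [hy]

variable [IsTree R]

/-- The least ordinal above the heights of all values of a condition. -/
noncomputable def rank (p : CountableSupportProduct ι R) : Ordinal.{u} :=
  ⨆ x : {x : ι × R // p.toFun x.1 = some x.2}, (height x.1.2 + 1)

theorem rank_lt_omega_one (hR : IsSuslin R) (p : CountableSupportProduct ι R) : rank p < ω₁ := by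
  have : Countable {x : ι × R // p.toFun x.1 = some x.2} := p.countable_graph.to_subtype
  exact Ordinal.iSup_lt_omega_one fun x => add_one_lt_omega_one (hR.height_lt _)

theorem height_lt_rank {p : CountableSupportProduct ι R} {i : ι} {x : R}
    (h : p.toFun i = some x) : height x < rank p :=
  lt_of_lt_of_le (Order.lt_add_one_iff.2 le_rfl)
    (Ordinal.le_iSup (fun x : {x : ι × R // p.toFun x.1 = some x.2} => height x.1.2 + 1)
      ⟨(i, x), h⟩)

/-- Countable ordinals are represented by the ranks of conditions, so that closure properties of a
family need to mention conditions only. -/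
theorem exists_lt_rank [Nonempty ι] (hR : IsSuslin R) {α : Ordinal.{u}} (hα : α < ω₁) :
    ∃ p : CountableSupportProduct ι R, α < rank p := by
  obtain ⟨r, rfl⟩ := hR.exists_height_eq α hα
  exact ⟨_, height_lt_rank (single_apply_self (Classical.arbitrary ι) r)⟩

/-! ### Countable closure operations -/

/-- The domain of p and the level `rank p₁` are both countable, hence so are the finite tuples drawn
from them. The additional p₂ makes the ranks in a closed family unbounded below their supremum. -/
theorem exists_countable_updateTuple_mem [Nonempty ι] (hR : IsSuslin R)
    (p p₁ : CountableSupportProduct ι R) :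
    ∃ C : Set (CountableSupportProduct ι R), C.Countable ∧ (∃ p₂ ∈ C, rank p < rank p₂) ∧
      ∀ (k : ℕ) (i : Fin k → ι) (a : Fin k → R), (∀ j, p.toFun (i j) ≠ none) →
        (∀ j, height (a j) = rank p₁) → updateTuple p i a ∈ C := by
  obtain ⟨p₂, hp₂⟩ := exists_lt_rank (ι := ι) hR (rank_lt_omega_one hR p)
  refine ⟨insert p₂ (⋃ k : ℕ, (fun x : (Fin k → ι) × (Fin k → R) => updateTuple p x.1 x.2) ''
    ({i | ∀ j, i j ∈ {i | p.toFun i ≠ none}} ×ˢ {a | ∀ j, a j ∈ {x | height x = rank p₁}})),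
    ?_, ⟨p₂, Set.mem_insert _ _, hp₂⟩, ?_⟩
  · refine (Set.countable_iUnion fun k => ((Set.countable_pi fun _ => p.countable_dom).prod
      (Set.countable_pi fun _ => hR.countable_level _)).image _).insert _
  · intro k i a hi ha
    exact Or.inr (Set.mem_iUnion.2 ⟨k, (i, a), ⟨hi, ha⟩, rfl⟩)

/-- The tuples `b` such that some extension of `p` in `D` has values below `b` at the indices
`i`. -/
def extensionTuples (p : CountableSupportProduct ι R) (D : Set (CountableSupportProduct ι R))
    {k : ℕ} (i : Fin k → ι) : Set (Fin k → R) :=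
  {b | ∃ p' ∈ D, p' ≤ p ∧ ∀ j, ∃ y, p'.toFun (i j) = some y ∧ y ≤ b j}

/-- Freeness is applied to the tuples above a. They are dense: move p up to b, extend into D, and
take a tuple above the resulting values. -/
theorem exists_forall_height_ge_mem_extensionTuples (hR : IsSuslin R) (hN : IsNormalTree R)
    (hF : IsFreeTree R) (p : CountableSupportProduct ι R) {D : Set (CountableSupportProduct ι R)}
    (hD : ForcingDense D) {k : ℕ} {i : Fin k → ι} (hi : Function.Injective i) {a : Fin k → R}
    (ha : Function.Injective a) (hah : ∀ j l, height (a j) = height (a l))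
    (hpa : ∀ j, p.toFun (i j) = some (a j)) :
    ∃ β < ω₁, ∀ b, a ≤ b → (∀ j l, height (b j) = height (b l)) → (∀ j, β ≤ height (b j)) →
      b ∈ extensionTuples p D i := by
  refine hF.exists_forall_height_ge_mem hR a ha hah _ ?_ ?_
  · rintro b ⟨p', hp'D, hp', h⟩ b' hb'
    refine ⟨p', hp'D, hp', fun j => ?_⟩
    obtain ⟨y, hy, hyb⟩ := h j
    exact ⟨y, hy, hyb.trans (hb' j)⟩
  · intro b hab _
    obtain ⟨p', hp'D, hp'⟩ := hD (updateTuple p i b)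
    have h1 : ∀ j, ∃ y, p'.toFun (i j) = some y ∧ b j ≤ y := fun j =>
      hp' _ _ (updateTuple_apply p hi b j)
    choose y hy hby using h1
    -- The values y may have different heights; raising them to the common level `rank p'` gives an
    -- element of the tree product.
    have h2 : ∀ j, ∃ z, y j ≤ z ∧ height z = rank p' := fun j =>
      hN.exists_ge_height_eq (y j) (height_lt_rank (hy j)).le (rank_lt_omega_one hR p')
    choose z hyz hz using h2
    refine ⟨z, ⟨p', hp'D, hp'.trans (updateTuple_le p hi b ?_), fun j => ⟨y j, hy j, hyz j⟩⟩,
      fun j => (hby j).trans (hyz j), fun j l => by rw [hz, hz]⟩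
    intro j x hx
    obtain rfl : a j = x := Option.some.inj ((hpa j).symm.trans hx)
    exact hab j

/-- The bound β serves all b at once, so on a single countable level above β one chosen witness for
each b is enough. The hypotheses on i and a stand inside the conclusion so that C can later be
chosen as a total function. -/
theorem exists_countable_extension_mem_of_tuple [Nonempty ι] (hR : IsSuslin R)
    (hN : IsNormalTree R) (hF : IsFreeTree R) (p : CountableSupportProduct ι R)
    {D : Set (CountableSupportProduct ι R)} (hD : ForcingDense D) {k : ℕ} (i : Fin k → ι)
    (a : Fin k → R) :
    ∃ C : Set (CountableSupportProduct ι R), C.Countable ∧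
      (Function.Injective i → Function.Injective a →
        (∀ j l, height (a j) = height (a l)) → (∀ j, p.toFun (i j) = some (a j)) →
        ∃ p₁ ∈ C, rank p ≤ rank p₁ ∧ ∀ b, a ≤ b → (∀ j, height (b j) = rank p₁) →
          b ∈ extensionTuples p (D ∩ C) i) := by
  by_cases hx : Function.Injective i ∧ Function.Injective a ∧
      (∀ j l, height (a j) = height (a l)) ∧ ∀ j, p.toFun (i j) = some (a j)
  swap
  · exact ⟨∅, Set.countable_empty, fun h1 h2 h3 h4 => absurd ⟨h1, h2, h3, h4⟩ hx⟩
  obtain ⟨hi, ha, hah, hpa⟩ := hx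
  obtain ⟨β, hβ, H⟩ :=
    exists_forall_height_ge_mem_extensionTuples hR hN hF p hD hi ha hah hpa
  obtain ⟨p₁, hp₁⟩ := exists_lt_rank (ι := ι) hR (max_lt hβ (rank_lt_omega_one hR p))
  have hw : ∀ b : Fin k → R, ∃ p', b ∈ extensionTuples p D i →
      b ∈ extensionTuples p (D ∩ {p'}) i := by
    intro b
    by_cases hb : b ∈ extensionTuples p D i
    · obtain ⟨p', hp', h⟩ := hb
      exact ⟨p', fun _ => ⟨p', ⟨hp', rfl⟩, h⟩⟩
    · exact ⟨p, fun h => absurd h hb⟩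
  choose w hw using hw
  refine ⟨insert p₁ (w '' {b | ∀ j, b j ∈ {y | height y = rank p₁}}),
    ((Set.countable_pi fun _ => hR.countable_level _).image _).insert _,
    fun _ _ _ _ => ⟨p₁, Set.mem_insert _ _, ((le_max_right _ _).trans hp₁.le),
      fun b hab hb => ?_⟩⟩
  obtain ⟨p', ⟨hp'D, rfl⟩, h⟩ := hw b (H b hab (fun j l => by rw [hb, hb])
    fun j => by rw [hb]; exact (le_max_left _ _).trans hp₁.le)
  exact ⟨w b, ⟨hp'D, Or.inr ⟨b, hb, rfl⟩⟩, h⟩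

theorem exists_countable_extension_mem [Nonempty ι] (hR : IsSuslin R) (hN : IsNormalTree R)
    (hF : IsFreeTree R) (p : CountableSupportProduct ι R)
    (D : Set (CountableSupportProduct ι R)) :
    ∃ C : Set (CountableSupportProduct ι R), C.Countable ∧ (ForcingDense D →
      ∀ (k : ℕ) (i : Fin k → ι) (a : Fin k → R), Function.Injective i → Function.Injective a →
        (∀ j l, height (a j) = height (a l)) → (∀ j, p.toFun (i j) = some (a j)) →
        ∃ p₁ ∈ C, rank p ≤ rank p₁ ∧ ∀ b, a ≤ b → (∀ j, height (b j) = rank p₁) →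
          b ∈ extensionTuples p (D ∩ C) i) := by
  by_cases hD : ForcingDense D
  swap
  · exact ⟨∅, Set.countable_empty, fun h => absurd h hD⟩
  have key := fun (k : ℕ) (x : Fin k → ι × R) => exists_countable_extension_mem_of_tuple hR hN hF
    p hD (fun j => (x j).1) (fun j => (x j).2)
  choose C hC hC' using key
  let E : ∀ k : ℕ, Set (Fin k → ι × R) := fun k => {x | ∀ j, x j ∈ {y | p.toFun y.1 = some y.2}}
  have hE : ∀ k, (E k).Countable := fun k => Set.countable_pi fun _ => p.countable_graph
  refine ⟨⋃ k : ℕ, ⋃ x ∈ E k, C k x,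
    Set.countable_iUnion fun k => (hE k).biUnion fun x _ => hC k x,
    fun _ k i a hi ha hah hpa => ?_⟩
  have hmem : (fun j => (i j, a j)) ∈ E k := hpa
  have hsub : C k (fun j => (i j, a j)) ⊆ ⋃ k : ℕ, ⋃ x ∈ E k, C k x :=
    fun q hq => Set.mem_iUnion.2 ⟨k, Set.mem_biUnion hmem hq⟩
  obtain ⟨p₁, hp₁, hpp₁, h⟩ := hC' k (fun j => (i j, a j)) hi ha hah hpa
  refine ⟨p₁, hsub hp₁, hpp₁, fun b hab hb => ?_⟩
  obtain ⟨p', ⟨hp'D, hp'C⟩, h'⟩ := h b hab hb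
  exact ⟨p', ⟨hp'D, hsub hp'C⟩, h'⟩

/-! ### Generic conditions for closed families -/

/-- The closure properties of a set `S` of conditions, relative to a family `𝒟` of dense sets,
which are used to build lower bounds that meet all members of `𝒟` inside `S`. -/
structure IsClosedFamily (S : Set (CountableSupportProduct ι R))
    (𝒟 : Set (Set (CountableSupportProduct ι R))) : Prop where
  exists_rank_lt : ∀ p ∈ S, ∃ p₁ ∈ S, rank p < rank p₁
  updateTuple_mem : ∀ p ∈ S, ∀ p₁ ∈ S, ∀ (k : ℕ) (i : Fin k → ι) (a : Fin k → R),
    (∀ j, p.toFun (i j) ≠ none) → (∀ j, height (a j) = rank p₁) → updateTuple p i a ∈ S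
  exists_mem_extensionTuples : ∀ p ∈ S, ∀ D ∈ 𝒟, ForcingDense D →
    ∀ (k : ℕ) (i : Fin k → ι) (a : Fin k → R), Function.Injective i → Function.Injective a →
      (∀ j l, height (a j) = height (a l)) → (∀ j, p.toFun (i j) = some (a j)) →
      ∃ p₁ ∈ S, rank p ≤ rank p₁ ∧ ∀ b, a ≤ b → (∀ j, height (b j) = rank p₁) →
        b ∈ extensionTuples p (D ∩ S) i

/-- `x` assigns distinct elements of level `δ` to the indices in `F`, above the values of
`p ∈ S`. -/
structure IsApproximation (S : Set (CountableSupportProduct ι R)) (δ : Ordinal.{u})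
    (p : CountableSupportProduct ι R) (F : Finset ι) (x : ι → R) : Prop where
  mem : p ∈ S
  injOn : Set.InjOn x F
  height_eq : ∀ i ∈ F, height (x i) = δ
  exists_le : ∀ i ∈ F, ∃ y, p.toFun i = some y ∧ y ≤ x i

namespace IsClosedFamily

variable {S : Set (CountableSupportProduct ι R)} {𝒟 : Set (Set (CountableSupportProduct ι R))}

theorem rank_lt_iSup (h : IsClosedFamily S 𝒟) {p} (hp : p ∈ S) : rank p < ⨆ p : S, rank p.1 := by
  obtain ⟨p₁, hp₁, hlt⟩ := h.exists_rank_lt p hp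
  exact hlt.trans_le (Ordinal.le_iSup (fun p : S => rank p.1) ⟨p₁, hp₁⟩)

theorem exists_lt_rank_of_lt_iSup {γ : Ordinal.{u}} (hγ : γ < ⨆ p : S, rank p.1) :
    ∃ p ∈ S, γ < rank p := by
  obtain ⟨p, hp⟩ := (Ordinal.lt_iSup_iff).1 hγ
  exact ⟨p.1, p.2, hp⟩

/-- Every rank in S is exceeded by another one, so the supremum is not attained. Being a limit, it
falls under the uniqueness clause of normality. -/
theorem isSuccLimit_iSup (h : IsClosedFamily S 𝒟) (hne : S.Nonempty) :
    Order.IsSuccLimit (⨆ p : S, rank p.1) := by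
  obtain ⟨p, hp⟩ := hne
  refine ⟨fun hmin => ?_, Order.isSuccPrelimit_of_succ_lt fun γ hγ => ?_⟩
  · exact (hmin.not_lt) (h.rank_lt_iSup hp)
  · obtain ⟨p', hp', hlt⟩ := exists_lt_rank_of_lt_iSup hγ
    exact (Order.succ_le_of_lt hlt).trans_lt (h.rank_lt_iSup hp')

/-- The promise x is kept by working with its restrictions to levels below δ: at a first level they
are distinct, so freeness applies, and at a second level they bound the values of an extension in D
∩ S. -/
theorem exists_extension_mem (hN : IsNormalTree R) (h : IsClosedFamily S 𝒟)
    {p : CountableSupportProduct ι R} {F : Finset ι} {x : ι → R}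
    (hp : IsApproximation S (⨆ p : S, rank p.1) p F x)
    {D : Set (CountableSupportProduct ι R)} (hD : D ∈ 𝒟) (hDd : ForcingDense D) :
    ∃ p' ∈ D, p' ≤ p ∧ IsApproximation S (⨆ p : S, rank p.1) p' F x := by
  set δ := ⨆ p : S, rank p.1 with hδ
  have hlim : Order.IsSuccLimit δ := h.isSuccLimit_iSup ⟨p, hp.mem⟩
  let i : Fin F.card → ι := fun j => (F.equivFin.symm j).1
  have hi : Function.Injective i := Subtype.val_injective.comp F.equivFin.symm.injective
  have hiF : ∀ j, i j ∈ F := fun j => (F.equivFin.symm j).2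
  -- Each pair of distinct promised values has a level from which their restrictions differ; the
  -- diagonal gets the dummy value 0.
  have hsep : ∀ jl : Fin F.card × Fin F.card, ∃ γ < δ, jl.1 ≠ jl.2 →
      ∀ a b, a ≤ x (i jl.1) → b ≤ x (i jl.2) → γ ≤ height a → a ≠ b := by
    rintro ⟨j, l⟩
    by_cases hjl : j = l
    · exact ⟨0, hlim.bot_lt, fun h => absurd hjl h⟩
    · have hne : x (i j) ≠ x (i l) := fun he => hjl (hi (hp.injOn (hiF j) (hiF l) he))
      have hj := hp.height_eq _ (hiF j)
      obtain ⟨γ, hγ, H⟩ := hN.exists_lt_forall_restrict_ne hne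
        (hj.trans (hp.height_eq _ (hiF l)).symm) (hj ▸ hlim)
      exact ⟨γ, hj ▸ hγ, fun _ => H⟩
  choose γ hγδ hγ using hsep
  -- A level above `rank p` makes the restrictions lie above the values of p, and a level above all
  -- γ makes them distinct.
  have hmax : max (rank p) (Finset.univ.sup γ) < δ :=
    max_lt (h.rank_lt_iSup hp.mem) ((Finset.sup_lt_iff hlim.bot_lt).2 fun jl _ => hγδ jl)
  obtain ⟨p₁, hp₁, hmax₁⟩ := exists_lt_rank_of_lt_iSup hmax
  have hp₁δ := h.rank_lt_iSup hp₁
  have ha : ∀ j, ∃ a ≤ x (i j), height a = rank p₁ := fun j =>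
    exists_le_height_eq (by rw [hp.height_eq _ (hiF j)]; exact hp₁δ.le)
  choose a hax ha using ha
  have hainj : Function.Injective a := by
    intro j l hjl
    by_contra hne
    refine hγ (j, l) hne (a j) (a l) (hax j) (hax l) ?_ hjl
    rw [ha]
    exact ((Finset.le_sup (Finset.mem_univ (j, l))).trans (le_max_right _ _)).trans hmax₁.le
  have hpdom : ∀ j, p.toFun (i j) ≠ none := fun j => by
    obtain ⟨y, hy, -⟩ := hp.exists_le _ (hiF j)
    simp [hy]
  have hp₂ : updateTuple p i a ∈ S := h.updateTuple_mem p hp.mem p₁ hp₁ _ i a hpdom ha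
  have hp₂p : updateTuple p i a ≤ p := by
    refine updateTuple_le p hi a fun j y hy => ?_
    obtain ⟨y', hy', hle⟩ := hp.exists_le _ (hiF j)
    obtain rfl : y' = y := Option.some.inj (hy'.symm.trans hy)
    refine le_of_le_of_height_le hle (hax j) ?_
    rw [ha]
    exact ((height_lt_rank hy).trans_le ((le_max_left _ _).trans hmax₁.le)).le
  obtain ⟨p₃, hp₃, hle, H⟩ := h.exists_mem_extensionTuples _ hp₂ D hD hDd _ i a hi hainj
    (fun j l => by rw [ha, ha]) (fun j => updateTuple_apply p hi a j)
  -- The tuple b is cut from x at a level supplied by S. It need not be known to S beforehand, since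
  -- p₃ works for every tuple on its level.
  have hb : ∀ j, ∃ b ≤ x (i j), height b = rank p₃ := fun j =>
    exists_le_height_eq (by rw [hp.height_eq _ (hiF j)]; exact (h.rank_lt_iSup hp₃).le)
  choose b hbx hb using hb
  obtain ⟨p', ⟨hp'D, hp'S⟩, hp', hval⟩ := H b (fun j => le_of_le_of_height_le (hax j) (hbx j) (by
    rw [hb]
    exact (height_lt_rank (updateTuple_apply p hi a j)).le.trans hle)) hb
  refine ⟨p', hp'D, hp'.trans hp₂p, hp'S, hp.injOn, hp.height_eq, fun l hl => ?_⟩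
  obtain ⟨y, hy, hyb⟩ := hval (F.equivFin ⟨l, hl⟩)
  have hil : i (F.equivFin ⟨l, hl⟩) = l := by simp [i]
  rw [hil] at hy
  refine ⟨y, hy, hyb.trans ((hbx _).trans ?_)⟩
  rw [hil]

/-- The new index needs a value on level δ above p(i₀) and different from the finitely many values
in use; the branching of a normal tree provides one. -/
theorem exists_extension_insert (hR : IsSuslin R) (hN : IsNormalTree R) (h : IsClosedFamily S 𝒟)
    (hS : S.Countable) {p : CountableSupportProduct ι R} {F : Finset ι} {x : ι → R}
    (hp : IsApproximation S (⨆ p : S, rank p.1) p F x) (i₀ : ι) :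
    ∃ F' x', IsApproximation S (⨆ p : S, rank p.1) p F' x' ∧ F ⊆ F' ∧ (∀ i ∈ F, x' i = x i) ∧
      (p.toFun i₀ ≠ none → i₀ ∈ F') := by
  classical
  by_cases hi₀ : p.toFun i₀ ≠ none ∧ i₀ ∉ F
  swap
  · exact ⟨F, x, hp, Finset.Subset.refl _, fun _ _ => rfl, by tauto⟩
  obtain ⟨hi₀, hi₀F⟩ := hi₀
  obtain ⟨y, hy⟩ := Option.ne_none_iff_exists'.1 hi₀
  have : Countable S := hS.to_subtype
  obtain ⟨z, hyz, hz, hzF⟩ := hN.exists_ge_height_eq_notMem (h.isSuccLimit_iSup ⟨p, hp.mem⟩)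
    (Ordinal.iSup_lt_omega_one fun p : S => rank_lt_omega_one hR p.1) (F.image x) y
    ((height_lt_rank hy).trans (h.rank_lt_iSup hp.mem))
  have hne : ∀ i ∈ F, i ≠ i₀ := fun i hi he => hi₀F (he ▸ hi)
  have hold : ∀ i ∈ F, Function.update x i₀ z i = x i := fun i hi =>
    Function.update_of_ne (hne i hi) _ _
  refine ⟨insert i₀ F, Function.update x i₀ z, ⟨hp.mem, ?_, ?_, ?_⟩, Finset.subset_insert _ _,
    hold, fun _ => Finset.mem_insert_self _ _⟩
  · rw [Finset.coe_insert, Set.injOn_insert (by simpa using hi₀F)]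
    refine ⟨fun i hi j hj hij => hp.injOn hi hj ?_, ?_⟩
    · rwa [hold i hi, hold j hj] at hij
    · rintro ⟨i, hi, he⟩
      rw [hold i hi, Function.update_self] at he
      exact hzF (Finset.mem_image.2 ⟨i, hi, he⟩)
  · intro i hi
    rcases Finset.mem_insert.1 hi with rfl | hi
    · rw [Function.update_self, hz]
    · rw [hold i hi, hp.height_eq i hi]
  · intro i hi
    rcases Finset.mem_insert.1 hi with rfl | hi
    · exact ⟨y, hy, by rwa [Function.update_self]⟩
    · rw [hold i hi]
      exact hp.exists_le i hi

/-- Every condition in a countable closed family `S` has an extension which lies below a member of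
`D ∩ S` for every dense `D ∈ 𝒟`. -/
theorem exists_le_forall_dense [Nonempty ι] (hR : IsSuslin R) (hN : IsNormalTree R)
    (h : IsClosedFamily S 𝒟) (hS : S.Countable) (h𝒟 : 𝒟.Countable)
    {p : CountableSupportProduct ι R} (hp : p ∈ S) :
    ∃ q ≤ p, ∀ D ∈ 𝒟, ForcingDense D → ∃ s ∈ D, s ∈ S ∧ q ≤ s := by
  -- Enumerating the dense members of 𝒟 by ℕ requires that there is at least one.
  rcases {D ∈ 𝒟 | ForcingDense D}.eq_empty_or_nonempty with hempty | hne
  · exact ⟨p, le_rfl, fun D hD hDd => absurd ⟨hD, hDd⟩ (Set.eq_empty_iff_forall_notMem.1 hempty D)⟩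
  obtain ⟨d, hd⟩ := (h𝒟.mono (Set.sep_subset _ _)).exists_eq_range hne
  have hd' : ∀ n, d n ∈ 𝒟 ∧ ForcingDense (d n) := fun n =>
    (hd ▸ Set.mem_range_self n : d n ∈ {D ∈ 𝒟 | ForcingDense D})
  -- An arbitrary index is inserted only to make the set of relevant indices nonempty.
  obtain ⟨e, he⟩ := ((hS.biUnion fun p _ => p.countable_dom).insert
    (Classical.arbitrary ι)).exists_eq_range (Set.insert_nonempty _ _)
  have he' : ∀ p ∈ S, ∀ i, p.toFun i ≠ none → ∃ n, e n = i := fun p hp i hi =>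
    (he ▸ Or.inr (Set.mem_biUnion hp hi) : i ∈ Set.range e)
  set δ := ⨆ p : S, rank p.1
  let State := {s : CountableSupportProduct ι R × Finset ι × (ι → R) //
    IsApproximation S δ s.1 s.2.1 s.2.2}
  have hstep : ∀ (s : State) (n : ℕ), ∃ t : State, t.1.1 ≤ s.1.1 ∧ t.1.1 ∈ d n.unpair.2 ∧
      s.1.2.1 ⊆ t.1.2.1 ∧ (∀ i ∈ s.1.2.1, t.1.2.2 i = s.1.2.2 i) ∧
      -- Stage n meets the dense set numbered `n.unpair.2` and treats the index numbered
      -- `n.unpair.1`. Each index recurs infinitely often, as it must, because it may enter the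
      -- domain late.
      (t.1.1.toFun (e n.unpair.1) ≠ none → e n.unpair.1 ∈ t.1.2.1) := by
    intro s n
    obtain ⟨p', hp'D, hp'le, hp'⟩ := h.exists_extension_mem hN s.2 (hd' n.unpair.2).1
      (hd' n.unpair.2).2
    obtain ⟨F', x', ht, hF, hx, hi⟩ := h.exists_extension_insert hR hN hS hp' (e n.unpair.1)
    exact ⟨⟨(p', F', x'), ht⟩, hp'le, hp'D, hF, hx, hi⟩
  choose next hle hmem hsub hval hdom using hstep
  obtain ⟨r, -⟩ := hN.exists_root
  let s : ℕ → State := fun n => Nat.rec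
    ⟨(p, ∅, fun _ => r), hp, by simp, by simp, by simp⟩ (fun n t => next t n) n
  have hanti : Antitone fun n => (s n).1.1 := antitone_nat_of_succ_le fun n => hle (s n) n
  have hmono : Monotone fun n => (s n).1.2.1 := monotone_nat_of_le_succ fun n => hsub (s n) n
  have hstable : ∀ n m, n ≤ m → ∀ i ∈ (s n).1.2.1, (s m).1.2.2 i = (s n).1.2.2 i := by
    intro n m hnm i hi
    induction m, hnm using Nat.le_induction with
    | base => rfl
    | succ m hnm ih => exact (hval (s m) m i (hmono hnm hi)).trans ih
  have hstable' : ∀ n m, ∀ i ∈ (s n).1.2.1, i ∈ (s m).1.2.1 →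
      (s m).1.2.2 i = (s n).1.2.2 i := by
    intro n m i hn hm
    rcases le_total n m with h | h
    · exact hstable n m h i hn
    · exact (hstable m n h i hm).symm
  have hcatch : ∀ n i, (s n).1.1.toFun i ≠ none → ∃ m ≥ n, i ∈ (s m).1.2.1 := by
    intro n i hi
    obtain ⟨l, rfl⟩ := he' _ (s n).2.mem i hi
    have h1 : n ≤ Nat.pair l n := Nat.right_le_pair l n
    have h2 := hdom (s (Nat.pair l n)) (Nat.pair l n)
    rw [Nat.unpair_pair] at h2
    exact ⟨Nat.pair l n + 1, by omega,
      h2 (ne_none_of_le (hanti (show n ≤ Nat.pair l n + 1 by omega)) hi)⟩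
  classical
  -- The stage picked by `choose` does not matter, since a promised value never changes.
  let q : CountableSupportProduct ι R :=
    { toFun := fun i => if hi : ∃ n, i ∈ (s n).1.2.1 then some ((s hi.choose).1.2.2 i) else none
      countable_dom := by
        refine (Set.countable_iUnion fun n => ((s n).1.2.1).countable_toSet).mono fun i hi => ?_
        by_contra hcon
        refine hi (dif_neg fun ⟨n, hn⟩ => hcon (Set.mem_iUnion.2 ⟨n, hn⟩)) }
  have hq : ∀ n i, i ∈ (s n).1.2.1 → q.toFun i = some ((s n).1.2.2 i) := by
    intro n i hi
    have hex : ∃ n, i ∈ (s n).1.2.1 := ⟨n, hi⟩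
    exact (dif_pos hex).trans (congrArg some (hstable' n _ i hi hex.choose_spec))
  have hqle : ∀ n, q ≤ (s n).1.1 := by
    intro n i y hy
    obtain ⟨m, hm, hi⟩ := hcatch n i (by simp [hy])
    refine ⟨_, hq m i hi, ?_⟩
    obtain ⟨y', hy', hyy'⟩ := hanti hm i y hy
    obtain ⟨z, hz, hzx⟩ := (s m).2.exists_le i hi
    obtain rfl : y' = z := Option.some.inj (hy'.symm.trans hz)
    exact hyy'.trans hzx
  refine ⟨q, hqle 0, fun D hD hDd => ?_⟩
  obtain ⟨n, rfl⟩ : D ∈ Set.range d := hd ▸ ⟨hD, hDd⟩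
  refine ⟨(s (Nat.pair 0 n + 1)).1.1, ?_, (s (Nat.pair 0 n + 1)).2.mem, hqle (Nat.pair 0 n + 1)⟩
  have := hmem (s (Nat.pair 0 n)) (Nat.pair 0 n)
  rwa [Nat.unpair_pair] at this

end IsClosedFamily

end CountableSupportProduct

/-! ### The closure operations and countable distributivity. -/

namespace CountableSupportProduct

variable {ι R : Type u} [PartialOrder R] [IsTree R]

/-- There are countable-valued operations such that in every countable family of conditions closed
under them, every condition has an extension that meets the given dense sets inside the family. -/
theorem exists_closure_operations [Nonempty ι] (hR : IsSuslin R) (hN : IsNormalTree R)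
    (hF : IsFreeTree R) :
    ∃ (C₁ : CountableSupportProduct ι R → CountableSupportProduct ι R →
        Set (CountableSupportProduct ι R))
      (C₂ : CountableSupportProduct ι R → Set (CountableSupportProduct ι R) →
        Set (CountableSupportProduct ι R)),
      (∀ p p₁, (C₁ p p₁).Countable) ∧ (∀ p D, (C₂ p D).Countable) ∧
      ∀ (S : Set (CountableSupportProduct ι R)) (𝒟 : Set (Set (CountableSupportProduct ι R))),
        S.Countable → 𝒟.Countable → (∀ p ∈ S, ∀ p₁ ∈ S, C₁ p p₁ ⊆ S) →
        (∀ p ∈ S, ∀ D ∈ 𝒟, C₂ p D ⊆ S) →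
        ∀ p ∈ S, ∃ q ≤ p, ∀ D ∈ 𝒟, ForcingDense D → ∃ s ∈ D, s ∈ S ∧ q ≤ s := by
  choose C₁ hC₁ hrank hupd using exists_countable_updateTuple_mem (ι := ι) hR
  choose C₂ hC₂ hext using exists_countable_extension_mem (ι := ι) hR hN hF
  refine ⟨C₁, C₂, hC₁, hC₂, fun S 𝒟 hS h𝒟 h₁ h₂ p hp => ?_⟩
  refine IsClosedFamily.exists_le_forall_dense hR hN ⟨?_, ?_, ?_⟩ hS h𝒟 hp
  · intro p hp
    obtain ⟨p₂, hp₂, h⟩ := hrank p p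
    exact ⟨p₂, h₁ p hp p hp hp₂, h⟩
  · intro p hp p₁ hp₁ k i a hi ha
    exact h₁ p hp p₁ hp₁ (hupd p p₁ k i a hi ha)
  · intro p hp D hD hDd k i a hi ha hah hpa
    obtain ⟨p₁, hp₁, hle, h⟩ := hext p D hDd k i a hi ha hah hpa
    refine ⟨p₁, h₂ p hp D hD hp₁, hle, fun b hab hb => ?_⟩
    obtain ⟨p', hp', h'⟩ := h b hab hb
    exact ⟨p', ⟨hp'.1, h₂ p hp D hD hp'.2⟩, h'⟩

/-- The set {p} is closed off under both operations in ω steps. The condition q obtained is below a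
member of each D n, hence belongs to D n by openness. -/
theorem isCountablyDistributive [Nonempty ι] (hR : IsSuslin R) (hN : IsNormalTree R)
    (hF : IsFreeTree R) : IsCountablyDistributive (CountableSupportProduct ι R) := by
  obtain ⟨C₁, C₂, hC₁, hC₂, H⟩ := exists_closure_operations (ι := ι) hR hN hF
  intro D hD p
  let S : ℕ → Set (CountableSupportProduct ι R) := fun n => Nat.rec {p} (fun _ T =>
    T ∪ ((⋃ x ∈ T, ⋃ y ∈ T, C₁ x y) ∪ ⋃ x ∈ T, ⋃ m, C₂ x (D m))) n
  have hSmono : Monotone S := monotone_nat_of_le_succ fun n => Set.subset_union_left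
  have hS : ∀ n, (S n).Countable := by
    intro n
    induction n with
    | zero => exact Set.countable_singleton p
    | succ n ih =>
      exact ih.union ((ih.biUnion fun x _ => ih.biUnion fun y _ => hC₁ x y).union
        (ih.biUnion fun x _ => Set.countable_iUnion fun m => hC₂ x (D m)))
  obtain ⟨q, hqp, hq⟩ := H (⋃ n, S n) (Set.range D) (Set.countable_iUnion hS)
    (Set.countable_range D) (by
      intro x hx y hy z hz
      obtain ⟨n, hn⟩ := Set.mem_iUnion.1 hx
      obtain ⟨m, hm⟩ := Set.mem_iUnion.1 hy
      refine Set.mem_iUnion.2 ⟨max n m + 1, Or.inr (Or.inl ?_)⟩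
      exact Set.mem_biUnion (hSmono (le_max_left n m) hn)
        (Set.mem_biUnion (hSmono (le_max_right n m) hm) hz)) (by
      rintro x hx _ ⟨m, rfl⟩ z hz
      obtain ⟨n, hn⟩ := Set.mem_iUnion.1 hx
      exact Set.mem_iUnion.2 ⟨n + 1, Or.inr (Or.inr
        (Set.mem_biUnion hn (Set.mem_iUnion.2 ⟨m, hz⟩)))⟩)
    p (Set.mem_iUnion.2 ⟨0, rfl⟩)
  refine ⟨q, Set.mem_iInter.2 fun n => ?_, hqp⟩
  obtain ⟨s, hsD, -, hqs⟩ := hq (D n) ⟨n, rfl⟩ (hD n).1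
  exact (hD n).2 hqs hsD

end CountableSupportProduct

/-! ### First-order definability and elementary substructures -/

namespace FirstOrder.Language

variable {L : Language.{0, 0}} {A : Type*} [L.Structure A]

/-- Existential quantification over the free variable `k`. -/
noncomputable def Formula.exAt (φ : L.Formula ℕ) (k : ℕ) : L.Formula ℕ :=
  BoundedFormula.ex (n := 0)
    (BoundedFormula.relabel (fun i => if i = k then Sum.inr (0 : Fin 1) else Sum.inl i) φ)

theorem Formula.realize_exAt (φ : L.Formula ℕ) (k : ℕ) (v : ℕ → A) :
    (φ.exAt k).Realize v ↔ ∃ a, φ.Realize (Function.update v k a) := by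
  unfold Formula.exAt Formula.Realize
  refine BoundedFormula.realize_ex.trans (exists_congr fun a => ?_)
  refine (BoundedFormula.realize_relabel (m := 1) (n := 0)).trans ?_
  have h : (Sum.elim v ((Fin.snoc default a : Fin 1 → A) ∘ Fin.castAdd 0) ∘
      fun i => if i = k then Sum.inr (0 : Fin 1) else Sum.inl i) = Function.update v k a := by
    funext i
    by_cases hi : i = k
    · subst hi
      simp [Fin.snoc]
    · simp [hi]
  exact iff_of_eq (congrArg₂ (fun w xs => BoundedFormula.Realize φ w xs) h
    (Subsingleton.elim _ _))

end FirstOrder.Language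

open FirstOrder Language

variable {θ : Cardinal.{u}}

/-- Predicates on assignments in `H(θ)` which are given by a first-order formula. -/
def IsFirstOrder (p : (ℕ → HSet θ) → Prop) : Prop :=
  ∃ φ : setTheoryLanguage.Formula ℕ, ∀ v, φ.Realize v ↔ p v

namespace IsFirstOrder

variable {p q : (ℕ → HSet θ) → Prop}

theorem congr (hp : IsFirstOrder p) (h : ∀ v, p v ↔ q v) : IsFirstOrder q := by
  obtain ⟨φ, hφ⟩ := hp
  exact ⟨φ, fun v => (hφ v).trans (h v)⟩

theorem mem (i j : ℕ) : IsFirstOrder fun v : ℕ → HSet θ => (v i).1 ∈ (v j).1 :=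
  ⟨Relations.formula₂ (L := setTheoryLanguage) SetTheoryRel.mem (Term.var i) (Term.var j),
    fun _ => Formula.realize_rel₂⟩

theorem eq (i j : ℕ) : IsFirstOrder fun v : ℕ → HSet θ => (v i).1 = (v j).1 :=
  ⟨Term.equal (Term.var i) (Term.var j), fun _ => Formula.realize_equal.trans Subtype.ext_iff⟩

theorem not (hp : IsFirstOrder p) : IsFirstOrder fun v => ¬ p v := by
  obtain ⟨φ, hφ⟩ := hp
  exact ⟨∼φ, fun v => Formula.realize_not.trans (not_congr (hφ v))⟩

theorem imp (hp : IsFirstOrder p) (hq : IsFirstOrder q) : IsFirstOrder fun v => p v → q v := by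
  obtain ⟨φ, hφ⟩ := hp
  obtain ⟨ψ, hψ⟩ := hq
  exact ⟨φ.imp ψ, fun v => Formula.realize_imp.trans (imp_congr (hφ v) (hψ v))⟩

theorem and (hp : IsFirstOrder p) (hq : IsFirstOrder q) : IsFirstOrder fun v => p v ∧ q v :=
  (hp.imp hq.not).not.congr fun v => by tauto

theorem or (hp : IsFirstOrder p) (hq : IsFirstOrder q) : IsFirstOrder fun v => p v ∨ q v :=
  (hp.not.imp hq).congr fun v => by tauto

theorem iff (hp : IsFirstOrder p) (hq : IsFirstOrder q) : IsFirstOrder fun v => p v ↔ q v :=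
  ((hp.imp hq).and (hq.imp hp)).congr fun v => by tauto

/-- Quantification over the variable `k`, which must not occur in `r` as a parameter. -/
theorem ex (k : ℕ) {r : (ℕ → HSet θ) → HSet θ → Prop} (hr : IsFirstOrder fun v => r v (v k))
    (h : ∀ v a, r (Function.update v k a) a = r v a) : IsFirstOrder fun v => ∃ a, r v a := by
  obtain ⟨φ, hφ⟩ := hr
  replace hφ : ∀ v, φ.Realize v ↔ r v (v k) := hφ
  refine ⟨φ.exAt k, fun v => (φ.realize_exAt k v).trans (exists_congr fun a => ?_)⟩
  rw [hφ, Function.update_self, h]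

theorem all (k : ℕ) {r : (ℕ → HSet θ) → HSet θ → Prop} (hr : IsFirstOrder fun v => r v (v k))
    (h : ∀ v a, r (Function.update v k a) a = r v a) : IsFirstOrder fun v => ∀ a, r v a :=
  (ex k (r := fun v a => ¬ r v a) hr.not fun v a => by rw [h]).not.congr fun v => by simp

/-- This Tarski–Vaught property is the form in which elementarity of M is used throughout. -/
theorem exists_mem (M : setTheoryLanguage.ElementarySubstructure (HSet θ)) (k : ℕ)
    {r : (ℕ → HSet θ) → HSet θ → Prop} (hr : IsFirstOrder fun v => r v (v k))
    (h : ∀ v a, r (Function.update v k a) a = r v a) {v : ℕ → HSet θ} (hv : ∀ i, v i ∈ M)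
    (hex : ∃ a, r v a) : ∃ a ∈ M, r v a := by
  obtain ⟨φ, hφ⟩ := hr
  replace hφ : ∀ v, φ.Realize v ↔ r v (v k) := hφ
  let w : ℕ → M := fun i => ⟨v i, hv i⟩
  have h1 : (φ.exAt k).Realize (M.subtype ∘ w) := by
    rw [Formula.realize_exAt]
    obtain ⟨a, ha⟩ := hex
    refine ⟨a, (hφ _).2 ?_⟩
    rw [Function.update_self, h]
    exact ha
  rw [ElementaryEmbedding.map_formula, Formula.realize_exAt] at h1
  obtain ⟨a, ha⟩ := h1
  refine ⟨a.1, a.2, ?_⟩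
  rw [← ElementaryEmbedding.map_formula M.subtype, Function.comp_update] at ha
  have := (hφ _).1 ha
  rw [Function.update_self] at this
  exact (h v a.1).mp this

end IsFirstOrder

/-! ### Closure properties of `H(θ)` -/

namespace HSet

variable {θ : Cardinal.{u}}

theorem mem_of_mem {x y : ZFSet.{u}} (hx : x ∈ HSet θ) (hy : y ∈ x) : y ∈ HSet θ := by
  obtain ⟨t, ht, hxt, hcard⟩ := hx
  exact ⟨t, ht, ht y (hxt hy), hcard⟩

theorem exists_forall_mem (x : ZFSet.{u}) :
    ∃ θ₀ : Cardinal.{u}, ∀ θ, θ₀ ≤ θ → x ∈ HSet θ := by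
  refine ⟨Order.succ (ZFSet.vonNeumann (ZFSet.rank x)).card, fun θ h => ⟨ZFSet.vonNeumann
    (ZFSet.rank x), ZFSet.isTransitive_vonNeumann _, ZFSet.subset_vonNeumann_self x, ?_⟩⟩
  exact (Order.lt_succ _).trans_le h

theorem range_mem (hθ : θ.IsRegular) (hθ₁ : ℵ₀ < θ) {f : ℕ → ZFSet.{u}} (hf : ∀ n, f n ∈ HSet θ) :
    ZFSet.range f ∈ HSet θ := by
  choose t ht hft hcard using hf
  -- The union of the t n stays below θ by regularity. `ULift` moves the index set into the universe
  -- of the cardinals.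
  have hunion : (ZFSet.iUnion fun n : ULift.{u} ℕ => t n.down).card < θ := by
    have h := ZFSet.lift_card_iUnion_le_sum_card (f := fun n : ULift.{u} ℕ => t n.down)
    rw [Cardinal.lift_id] at h
    refine h.trans_lt (Cardinal.sum_lt_of_isRegular hθ ?_ fun n => hcard n.down)
    simpa using hθ₁
  have hrange : (ZFSet.range fun n : ULift.{u} ℕ => f n.down).card < θ := by
    have h := ZFSet.lift_card_range_le (f := fun n : ULift.{u} ℕ => f n.down)
    rw [Cardinal.lift_id, Cardinal.lift_id] at h
    exact h.trans_lt (by simpa using hθ₁)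
  refine ⟨ZFSet.range f ∪ ZFSet.iUnion fun n : ULift.{u} ℕ => t n.down, ?_, ?_, ?_⟩
  · intro y hy z hz
    rw [ZFSet.mem_union]
    right
    rcases ZFSet.mem_union.1 hy with hy | hy
    · obtain ⟨n, rfl⟩ := ZFSet.mem_range.1 hy
      exact ZFSet.mem_iUnion.2 ⟨⟨n⟩, hft n hz⟩
    · obtain ⟨n, hn⟩ := ZFSet.mem_iUnion.1 hy
      exact ZFSet.mem_iUnion.2 ⟨n, ht n.down y hn hz⟩
  · exact fun y hy => ZFSet.mem_union.2 (Or.inl hy)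
  · have he : ZFSet.range f = ZFSet.range fun n : ULift.{u} ℕ => f n.down := by
      ext y
      simp
    rw [he]
    exact ZFSet.card_union_le.trans_lt (Cardinal.add_lt_of_lt hθ.aleph0_le hrange hunion)

theorem empty_mem (hθ : θ.IsRegular) : (∅ : ZFSet.{u}) ∈ HSet θ :=
  ⟨∅, ZFSet.isTransitive_empty, fun _ h => h, by simpa using hθ.pos⟩

/-- Countable subsets of `H(θ)` belong to `H(θ)`. -/
theorem exists_mem_of_countable (hθ : θ.IsRegular) (hθ₁ : ℵ₀ < θ) {S : Set ZFSet.{u}}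
    (hS : S.Countable) (h : S ⊆ HSet θ) : ∃ x ∈ HSet θ, ∀ y, y ∈ x ↔ y ∈ S := by
  rcases S.eq_empty_or_nonempty with rfl | hne
  · exact ⟨∅, empty_mem hθ, by simp⟩
  · obtain ⟨f, rfl⟩ := hS.exists_eq_range hne
    exact ⟨ZFSet.range f, range_mem hθ hθ₁ fun n => h ⟨n, rfl⟩, fun y => ZFSet.mem_range⟩

theorem of_countable (hθ : θ.IsRegular) (hθ₁ : ℵ₀ < θ) {x : ZFSet.{u}}
    (hx : {y | y ∈ x}.Countable) (h : ∀ y ∈ x, y ∈ HSet θ) : x ∈ HSet θ := by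
  obtain ⟨z, hz, hzx⟩ := exists_mem_of_countable hθ hθ₁ hx h
  rwa [show x = z from ZFSet.ext fun y => (hzx y).symm]

theorem upair_mem (hθ : θ.IsRegular) (hθ₁ : ℵ₀ < θ) {x y : ZFSet.{u}} (hx : x ∈ HSet θ)
    (hy : y ∈ HSet θ) : ({x, y} : ZFSet.{u}) ∈ HSet θ := by
  refine of_countable hθ hθ₁ ?_ ?_
  · refine (Set.toFinite {x, y}).countable.mono fun z hz => ?_
    exact ZFSet.mem_pair.1 hz
  · intro z hz
    rcases ZFSet.mem_pair.1 hz with rfl | rfl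
    exacts [hx, hy]

theorem singleton_mem (hθ : θ.IsRegular) (hθ₁ : ℵ₀ < θ) {x : ZFSet.{u}} (hx : x ∈ HSet θ) :
    ({x} : ZFSet.{u}) ∈ HSet θ := by
  rw [← ZFSet.pair_eq_singleton]
  exact upair_mem hθ hθ₁ hx hx

theorem pair_mem (hθ : θ.IsRegular) (hθ₁ : ℵ₀ < θ) {x y : ZFSet.{u}} (hx : x ∈ HSet θ)
    (hy : y ∈ HSet θ) : ZFSet.pair x y ∈ HSet θ :=
  upair_mem hθ hθ₁ (singleton_mem hθ hθ₁ hx) (upair_mem hθ hθ₁ hx hy)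

theorem fst_mem_of_pair_mem {x y : ZFSet.{u}} (h : ZFSet.pair x y ∈ HSet θ) : x ∈ HSet θ :=
  mem_of_mem (mem_of_mem h (by simp [ZFSet.pair] : ({x} : ZFSet.{u}) ∈ ZFSet.pair x y)) (by simp)

theorem snd_mem_of_pair_mem {x y : ZFSet.{u}} (h : ZFSet.pair x y ∈ HSet θ) : y ∈ HSet θ :=
  mem_of_mem (mem_of_mem h (by simp [ZFSet.pair] : ({x, y} : ZFSet.{u}) ∈ ZFSet.pair x y)) (by simp)

theorem ext_iff {x y : ZFSet.{u}} (hx : x ∈ HSet θ) (hy : y ∈ HSet θ) :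
    x = y ↔ ∀ z : HSet θ, z.1 ∈ x ↔ z.1 ∈ y := by
  constructor
  · rintro rfl z
    rfl
  · intro h
    refine ZFSet.ext fun z => ⟨fun hz => (h ⟨z, mem_of_mem hx hz⟩).1 hz,
      fun hz => (h ⟨z, mem_of_mem hy hz⟩).2 hz⟩

end HSet

/-! ### Definability of ordered pairs in H(θ). -/

namespace IsFirstOrder

variable {θ : Cardinal.{u}}

/-- A quantified variable must differ from the parameters. The numbers 97 to 100 are reserved for
the formulas about pairs, which leaves small numbers to the formulas built on them. -/
theorem isUPair (hθ : θ.IsRegular) (hθ₁ : ℵ₀ < θ) {t a b : ℕ} (ht : t < 100) (ha : a < 100)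
    (hb : b < 100) : IsFirstOrder fun v : ℕ → HSet θ => (v t).1 = {(v a).1, (v b).1} := by
  refine (all 100 (r := fun v z => z.1 ∈ (v t).1 ↔ z.1 = (v a).1 ∨ z.1 = (v b).1)
    ((mem 100 t).iff ((eq 100 a).or (eq 100 b))) ?_).congr fun v => ?_
  · intro v z
    simp [Function.update_of_ne ht.ne, Function.update_of_ne ha.ne, Function.update_of_ne hb.ne]
  · rw [HSet.ext_iff (v t).2 (HSet.upair_mem hθ hθ₁ (v a).2 (v b).2)]
    simp

theorem isPair (hθ : θ.IsRegular) (hθ₁ : ℵ₀ < θ) {t a b : ℕ} (ht : t < 98) (ha : a < 98)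
    (hb : b < 98) : IsFirstOrder fun v : ℕ → HSet θ => (v t).1 = ZFSet.pair (v a).1 (v b).1 := by
  refine (ex 98 (r := fun v x => ∃ y : HSet θ, x.1 = {(v a).1, (v a).1} ∧
    y.1 = {(v a).1, (v b).1} ∧ (v t).1 = {x.1, y.1})
    (ex 99 (r := fun v y => (v 98).1 = {(v a).1, (v a).1} ∧
      y.1 = {(v a).1, (v b).1} ∧ (v t).1 = {(v 98).1, y.1})
      ((isUPair hθ hθ₁ (by omega) (by omega) (by omega)).and
        ((isUPair hθ hθ₁ (by omega) (by omega) (by omega)).and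
          (isUPair hθ hθ₁ (by omega) (by omega) (by omega)))) ?_) ?_).congr fun v => ?_
  · intro v z
    simp [Function.update_of_ne (show t ≠ 99 by omega), Function.update_of_ne (show a ≠ 99 by omega),
      Function.update_of_ne (show b ≠ 99 by omega)]
  · intro v z
    simp [Function.update_of_ne (show t ≠ 98 by omega), Function.update_of_ne (show a ≠ 98 by omega),
      Function.update_of_ne (show b ≠ 98 by omega)]
  · constructor
    · rintro ⟨x, y, hx, hy, h⟩
      rw [h, hx, hy, ZFSet.pair_eq_singleton, ZFSet.pair]
    · intro h
      refine ⟨⟨_, HSet.singleton_mem hθ hθ₁ (v a).2⟩,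
        ⟨_, HSet.upair_mem hθ hθ₁ (v a).2 (v b).2⟩, ?_, rfl, h⟩
      exact (ZFSet.pair_eq_singleton _).symm

theorem pair_mem (hθ : θ.IsRegular) (hθ₁ : ℵ₀ < θ) {a b w : ℕ} (ha : a < 97) (hb : b < 97)
    (hw : w < 97) : IsFirstOrder fun v : ℕ → HSet θ => ZFSet.pair (v a).1 (v b).1 ∈ (v w).1 := by
  refine (ex 97 (r := fun v t => t.1 = ZFSet.pair (v a).1 (v b).1 ∧ t.1 ∈ (v w).1)
    ((isPair hθ hθ₁ (by omega) (by omega) (by omega)).and (mem 97 w)) ?_).congr fun v => ?_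
  · intro v z
    simp [Function.update_of_ne ha.ne, Function.update_of_ne hb.ne, Function.update_of_ne hw.ne]
  · constructor
    · rintro ⟨t, ht, h⟩
      rwa [← ht]
    · exact fun h => ⟨⟨_, HSet.mem_of_mem (v w).2 h⟩, rfl, h⟩

end IsFirstOrder

/-! ### Closed sets and sets controlling a forcing notion -/

/-- A nonempty set without `∈`-maximal element; such sets are infinite. -/
def IsUnboundedSet {θ : Cardinal.{u}} (O : HSet θ) : Prop :=
  (∃ o : HSet θ, o.1 ∈ O.1) ∧ ∀ o : HSet θ, o.1 ∈ O.1 → ∃ o' : HSet θ, o'.1 ∈ O.1 ∧ o.1 ∈ o'.1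

/-- Countability as a first-order property of `H(θ)`: every unbounded set can be mapped onto a set
that covers `N`. -/
def IsCountableSet {θ : Cardinal.{u}} (N : HSet θ) : Prop :=
  ∀ O : HSet θ, IsUnboundedSet O → ∃ g : HSet θ,
    (∀ o w w' : HSet θ, ZFSet.pair o.1 w.1 ∈ g.1 → ZFSet.pair o.1 w'.1 ∈ g.1 → w.1 = w'.1) ∧
    ∀ y : HSet θ, y.1 ∈ N.1 → ∃ o : HSet θ, o.1 ∈ O.1 ∧ ZFSet.pair o.1 y.1 ∈ g.1

/-- `N` contains the empty set and is closed under pairing and under the (partial) operation with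
graph `W`. -/
def IsClosedSet {θ : Cardinal.{u}} (W N : HSet θ) : Prop :=
  (∃ o : HSet θ, o.1 ∈ N.1 ∧ ∀ z : HSet θ, ¬ z.1 ∈ o.1) ∧
  (∀ a : HSet θ, a.1 ∈ N.1 → ∀ b : HSet θ, b.1 ∈ N.1 → ZFSet.pair a.1 b.1 ∈ N.1) ∧
  ∀ a : HSet θ, a.1 ∈ N.1 → (∃ w : HSet θ, ZFSet.pair a.1 w.1 ∈ W.1) →
    ∃ w : HSet θ, w.1 ∈ N.1 ∧ ZFSet.pair a.1 w.1 ∈ W.1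

/-- The conditions of the forcing notion `(Q, E)` in `N` have extensions which lie below members of
`D ∩ N` for all dense sets `D ∈ N`. -/
def HasGenericExtensions {θ : Cardinal.{u}} (N Q E : HSet θ) : Prop :=
  ∀ p : HSet θ, p.1 ∈ N.1 → p.1 ∈ Q.1 → ∃ q : HSet θ, ZFSet.pair q.1 p.1 ∈ E.1 ∧
    ∀ D : HSet θ, D.1 ∈ N.1 → (∀ x : HSet θ, x.1 ∈ D.1 → x.1 ∈ Q.1) →
      (∀ x : HSet θ, x.1 ∈ Q.1 → ∃ y : HSet θ, y.1 ∈ D.1 ∧ ZFSet.pair y.1 x.1 ∈ E.1) →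
      ∃ s : HSet θ, s.1 ∈ D.1 ∧ s.1 ∈ N.1 ∧ ZFSet.pair q.1 s.1 ∈ E.1

/-- Countable sets closed under the operation with graph `W` have generic extensions. -/
def IsControlling {θ : Cardinal.{u}} (W Q E : HSet θ) : Prop :=
  ∀ N : HSet θ, IsClosedSet W N → IsCountableSet N → HasGenericExtensions N Q E

/-! ### Definability of the controlling property. -/

namespace IsFirstOrder

variable {θ : Cardinal.{u}}

theorem isUnboundedSet (i : ℕ) (hi : i < 10) :
    IsFirstOrder fun v : ℕ → HSet θ => IsUnboundedSet (v i) := by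
  refine and (ex 10 (mem 10 i) ?_) (all 10 ((mem 10 i).imp (ex 11 ((mem 11 i).and (mem 10 11)) ?_))
    ?_)
  all_goals
    intro v a
    simp [Function.update_of_ne (show i ≠ 10 by omega), Function.update_of_ne (show i ≠ 11 by omega)]

/-- From here on the variables 0, 1, 2 stand for W, Q, E and 3 for N. Bound variables start at 4,
and with concrete numbers the side conditions hold by `rfl`. -/
theorem isCountableSet (hθ : θ.IsRegular) (hθ₁ : ℵ₀ < θ) :
    IsFirstOrder fun v : ℕ → HSet θ => IsCountableSet (v 3) := by
  refine all 4 ((isUnboundedSet 4 (by omega)).imp (ex 5 (and (all 6 (all 7 (all 8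
    ((pair_mem hθ hθ₁ (a := 6) (b := 7) (w := 5) (by omega) (by omega) (by omega)).imp
      ((pair_mem hθ hθ₁ (a := 6) (b := 8) (w := 5) (by omega) (by omega) (by omega)).imp (eq 7 8)))
    ?_) ?_) ?_)
    (all 6 ((mem 6 3).imp (ex 7 ((mem 7 4).and
      (pair_mem hθ hθ₁ (a := 7) (b := 6) (w := 5) (by omega) (by omega) (by omega))) ?_)) ?_)) ?_))
    ?_
  all_goals
    intro v a
    rfl

theorem isClosedSet (hθ : θ.IsRegular) (hθ₁ : ℵ₀ < θ) :
    IsFirstOrder fun v : ℕ → HSet θ => IsClosedSet (v 0) (v 3) := by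
  refine and (ex 4 ((mem 4 3).and (all 5 (mem 5 4).not ?_)) ?_) (and
    (all 4 ((mem 4 3).imp (all 5 ((mem 5 3).imp
      (pair_mem hθ hθ₁ (a := 4) (b := 5) (w := 3) (by omega) (by omega) (by omega))) ?_)) ?_)
    (all 4 ((mem 4 3).imp (imp
      (ex 5 (pair_mem hθ hθ₁ (a := 4) (b := 5) (w := 0) (by omega) (by omega) (by omega)) ?_)
      (ex 5 ((mem 5 3).and
        (pair_mem hθ hθ₁ (a := 4) (b := 5) (w := 0) (by omega) (by omega) (by omega))) ?_))) ?_))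
  all_goals
    intro v a
    rfl

theorem hasGenericExtensions (hθ : θ.IsRegular) (hθ₁ : ℵ₀ < θ) :
    IsFirstOrder fun v : ℕ → HSet θ => HasGenericExtensions (v 3) (v 1) (v 2) := by
  refine all 4 ((mem 4 3).imp ((mem 4 1).imp (ex 5 ((pair_mem hθ hθ₁ (a := 5) (b := 4) (w := 2)
    (by omega) (by omega) (by omega)).and (all 6 ((mem 6 3).imp (imp
      (all 7 ((mem 7 6).imp (mem 7 1)) ?_) (imp
      (all 7 ((mem 7 1).imp (ex 8 ((mem 8 6).and (pair_mem hθ hθ₁ (a := 8) (b := 7) (w := 2)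
        (by omega) (by omega) (by omega))) ?_)) ?_)
      (ex 7 ((mem 7 6).and ((mem 7 3).and (pair_mem hθ hθ₁ (a := 5) (b := 7) (w := 2)
        (by omega) (by omega) (by omega)))) ?_)))) ?_)) ?_))) ?_
  all_goals
    intro v a
    rfl

theorem isControlling (hθ : θ.IsRegular) (hθ₁ : ℵ₀ < θ) :
    IsFirstOrder fun v : ℕ → HSet θ => IsControlling (v 0) (v 1) (v 2) :=
  all 3 ((isClosedSet hθ hθ₁).imp ((isCountableSet hθ hθ₁).imp (hasGenericExtensions hθ hθ₁)))
    fun _ _ => rfl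

end IsFirstOrder

/-! ### Countability inside `H(θ)` -/

/-- An unbounded O contains an ∈-increasing sequence, which is injective because ranks increase.
Pairing it with an enumeration of N gives a countable subset of H(θ), hence an element. -/
theorem isCountableSet_of_countable {θ : Cardinal.{u}} (hθ : θ.IsRegular) (hθ₁ : ℵ₀ < θ)
    {N : HSet θ} (hne : ∃ y, y ∈ N.1) (hN : {y | y ∈ N.1}.Countable) : IsCountableSet N := by
  obtain ⟨y, hy⟩ := hN.exists_eq_range hne
  have hyN : ∀ n, y n ∈ N.1 := fun n => (hy ▸ Set.mem_range_self n : y n ∈ {y | y ∈ N.1})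
  rintro O ⟨⟨o₀, ho₀⟩, hO⟩
  have hO' : ∀ o : {o : HSet θ // o.1 ∈ O.1}, ∃ o' : {o : HSet θ // o.1 ∈ O.1}, o.1.1 ∈ o'.1.1 :=
    fun o => by
      obtain ⟨o', ho', h⟩ := hO o.1 o.2
      exact ⟨⟨o', ho'⟩, h⟩
  choose next hnext using hO'
  let o : ℕ → {o : HSet θ // o.1 ∈ O.1} := fun n => Nat.rec ⟨o₀, ho₀⟩ (fun _ x => next x) n
  have hmono : StrictMono fun n => ZFSet.rank (o n).1.1 :=
    strictMono_nat_of_lt_succ fun n => ZFSet.rank_lt_of_mem (hnext (o n))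
  have hinj : ∀ n m, (o n).1.1 = (o m).1.1 → n = m := fun n m h =>
    hmono.injective (congrArg ZFSet.rank h)
  refine ⟨⟨ZFSet.range fun n => ZFSet.pair (o n).1.1 (y n), HSet.range_mem hθ hθ₁ fun n =>
    HSet.pair_mem hθ hθ₁ (o n).1.2 (HSet.mem_of_mem N.2 (hyN n))⟩, ?_, ?_⟩
  · intro a w w' hw hw'
    obtain ⟨n, hn⟩ := ZFSet.mem_range.1 hw
    obtain ⟨m, hm⟩ := ZFSet.mem_range.1 hw'
    obtain ⟨hn1, hn2⟩ := ZFSet.pair_inj.1 hn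
    obtain ⟨hm1, hm2⟩ := ZFSet.pair_inj.1 hm
    rw [← hn2, ← hm2, hinj n m (hn1.trans hm1.symm)]
  · intro z hz
    obtain ⟨n, hn⟩ : z.1 ∈ Set.range y := hy ▸ hz
    exact ⟨(o n).1, (o n).2, ZFSet.mem_range.2 ⟨n, by rw [hn]⟩⟩

/-- The iterated singletons of the empty set. -/
noncomputable def iterSingleton : ℕ → ZFSet.{u}
  | 0 => ∅
  | n + 1 => {iterSingleton n}

/-- It suffices to take for O the set of iterated singletons of ∅, which is unbounded and countable.
With the converse above, the first-order notion agrees with true countability for nonempty N, and ω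
need not be defined by a formula. -/
theorem countable_of_isCountableSet {θ : Cardinal.{u}} (hθ : θ.IsRegular) (hθ₁ : ℵ₀ < θ)
    {N : HSet θ} (hN : IsCountableSet N) : {y | y ∈ N.1}.Countable := by
  have hmem : ∀ n, iterSingleton.{u} n ∈ HSet θ := by
    intro n
    induction n with
    | zero => exact HSet.empty_mem hθ
    | succ n ih => exact HSet.singleton_mem hθ hθ₁ ih
  obtain ⟨g, hg, hgN⟩ := hN ⟨ZFSet.range iterSingleton, HSet.range_mem hθ hθ₁ hmem⟩ (by
    refine ⟨⟨⟨_, hmem 0⟩, ZFSet.mem_range_self 0⟩, ?_⟩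
    intro o ho
    obtain ⟨n, hn⟩ := ZFSet.mem_range.1 ho
    exact ⟨⟨_, hmem (n + 1)⟩, ZFSet.mem_range.2 ⟨n + 1, rfl⟩, by simp [iterSingleton, ← hn]⟩)
  have h : ∀ y : {y | y ∈ N.1}, ∃ n : ℕ, ZFSet.pair (iterSingleton n) y.1 ∈ g.1 := by
    intro y
    obtain ⟨o, ho, hoy⟩ := hgN ⟨y.1, HSet.mem_of_mem N.2 y.2⟩ y.2
    obtain ⟨n, hn⟩ := ZFSet.mem_range.1 ho
    exact ⟨n, by rwa [hn]⟩
  choose f hf using h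
  refine Set.countable_coe_iff.1 (Function.Injective.countable (f := f) fun y z hyz => ?_)
  exact Subtype.ext (hg ⟨_, hmem (f y)⟩ ⟨y.1, HSet.mem_of_mem N.2 y.2⟩
    ⟨z.1, HSet.mem_of_mem N.2 z.2⟩ (hf y) (by rw [hyz]; exact hf z))

/-! ### Elementary substructures as closed sets -/

section ElementarySubstructure

variable {θ : Cardinal.{u}} (M : setTheoryLanguage.ElementarySubstructure (HSet θ))

theorem mem_elemsOf {x : HSet θ} : x.1 ∈ elemsOf M ↔ x ∈ M :=
  ⟨fun ⟨_, hy, h⟩ => Subtype.ext h ▸ hy, fun h => ⟨x, h, rfl⟩⟩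

variable {M}

/-- The empty set, pairs and values of W are all existence statements with parameters in M, so
elementarity puts witnesses into M. -/
theorem isClosedSet_of_elementarySubstructure (hθ : θ.IsRegular) (hθ₁ : ℵ₀ < θ) {N W : HSet θ}
    (hN : ∀ x : HSet θ, x.1 ∈ N.1 ↔ x ∈ M) (hW : W ∈ M) : IsClosedSet W N := by
  refine ⟨?_, ?_, ?_⟩
  · obtain ⟨a, ha, h⟩ := IsFirstOrder.exists_mem M 0 (r := fun _ a => ∀ z : HSet θ, ¬ z.1 ∈ a.1)
      (IsFirstOrder.all 1 (IsFirstOrder.mem 1 0).not fun _ _ => rfl) (fun _ _ => rfl)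
      (v := fun _ => W) (fun _ => hW) ⟨⟨∅, HSet.empty_mem hθ⟩, by simp⟩
    exact ⟨a, (hN a).2 ha, h⟩
  · intro a ha b hb
    obtain ⟨t, ht, h⟩ := IsFirstOrder.exists_mem M 2
      (r := fun v t => t.1 = ZFSet.pair (v 0).1 (v 1).1)
      (IsFirstOrder.isPair hθ hθ₁ (by omega) (by omega) (by omega)) (fun _ _ => rfl)
      (v := fun i => if i = 0 then a else b)
      (fun i => by split_ifs; exacts [(hN a).1 ha, (hN b).1 hb])
      ⟨⟨_, HSet.pair_mem hθ hθ₁ a.2 b.2⟩, rfl⟩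
    exact h ▸ (hN t).2 ht
  · intro a ha hw
    obtain ⟨w, hw, h⟩ := IsFirstOrder.exists_mem M 2
      (r := fun v w => ZFSet.pair (v 0).1 w.1 ∈ (v 1).1)
      (IsFirstOrder.pair_mem hθ hθ₁ (by omega) (by omega) (by omega)) (fun _ _ => rfl)
      (v := fun i => if i = 0 then a else W)
      (fun i => by split_ifs; exacts [(hN a).1 ha, hW]) hw
    exact ⟨w, (hN w).2 hw, h⟩

theorem exists_mem_elementarySubstructure_eq_pair (hθ : θ.IsRegular) (hθ₁ : ℵ₀ < θ)
    {x y : ZFSet.{u}} (h : ZFSet.pair x y ∈ elemsOf M) : ∃ a ∈ M, ∃ b ∈ M, a.1 = x ∧ b.1 = y := by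
  obtain ⟨z, hz, hzxy⟩ := h
  have hx : x ∈ HSet θ := HSet.fst_mem_of_pair_mem (hzxy ▸ z.2)
  have hy : y ∈ HSet θ := HSet.snd_mem_of_pair_mem (hzxy ▸ z.2)
  obtain ⟨a, ha, b, hab⟩ := IsFirstOrder.exists_mem M 1
    (r := fun v a => ∃ b : HSet θ, (v 0).1 = ZFSet.pair a.1 b.1)
    (IsFirstOrder.ex 2 (IsFirstOrder.isPair hθ hθ₁ (by omega) (by omega) (by omega))
      fun _ _ => rfl) (fun _ _ => rfl)
    (v := fun _ => z) (fun _ => hz) ⟨⟨x, hx⟩, ⟨y, hy⟩, hzxy⟩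
  obtain ⟨b', hb', hab'⟩ := IsFirstOrder.exists_mem M 2
    (r := fun v b => (v 0).1 = ZFSet.pair (v 1).1 b.1)
    (IsFirstOrder.isPair hθ hθ₁ (by omega) (by omega) (by omega)) (fun _ _ => rfl)
    (v := fun i => if i = 0 then z else a)
    (fun i => by split_ifs; exacts [hz, ha]) ⟨b, hab⟩
  obtain ⟨h1, h2⟩ := ZFSet.pair_inj.1 ((show z.1 = ZFSet.pair a.1 b'.1 from hab').symm.trans hzxy)
  exact ⟨a, ha, b', hb', h1, h2⟩

end ElementarySubstructure

/-! ### A criterion for properness -/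

theorem codeSet_injective {P : Type u} {c : P → ZFSet.{u}} (hc : Function.Injective c) :
    Function.Injective (codeSet c) := by
  intro D E h
  have key : ∀ (D : Set P) p, c p ∈ codeSet c D ↔ p ∈ D := by
    intro D p
    rw [codeSet, ZFSet.mem_range]
    exact ⟨fun ⟨q, hq⟩ => hc hq ▸ q.2, fun hp => ⟨⟨p, hp⟩, rfl⟩⟩
  ext p
  rw [← key D, h, key E]

/-- Codes of the natural numbers which belong to every set that contains the empty set and is closed
under pairing. -/
noncomputable def natCode : ℕ → ZFSet.{u}
  | 0 => ∅
  | n + 1 => ZFSet.pair (natCode n) (natCode n)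

theorem natCode_injective : Function.Injective natCode.{u} := by
  have h0 : ∀ x y : ZFSet.{u}, ZFSet.pair x y ≠ ∅ := fun x y h =>
    ZFSet.notMem_empty {x} (h ▸ by simp [ZFSet.pair])
  intro n
  induction n with
  | zero =>
    rintro (_ | m) h
    · rfl
    · exact absurd h.symm (h0 _ _)
  | succ n ih =>
    rintro (_ | m) h
    · exact absurd h (h0 _ _)
    · exact congrArg _ (ih (ZFSet.pair_inj.1 h).1)

theorem IsClosedSet.natCode_mem {θ : Cardinal.{u}} {W N : HSet θ} (h : IsClosedSet W N) (n : ℕ) :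
    natCode n ∈ N.1 := by
  induction n with
  | zero =>
    obtain ⟨o, ho, hempty⟩ := h.1
    have : o.1 = ∅ := (ZFSet.eq_empty _).2 fun y hy =>
      hempty ⟨y, HSet.mem_of_mem o.2 hy⟩ hy
    rw [natCode, ← this]
    exact ho
  | succ n ih =>
    exact h.2.1 ⟨_, HSet.mem_of_mem N.2 ih⟩ ih ⟨_, HSet.mem_of_mem N.2 ih⟩ ih

/-- A binary operation with countable sets as values is captured by closure under the graph of a
suitable operation. -/
theorem exists_graph_closed {I : Type u} (e : I → ZFSet.{u}) (F : ZFSet.{u} → ZFSet.{u} →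
    Set ZFSet.{u}) (hF : ∀ x y, (F x y).Countable) :
    ∃ W : ZFSet.{u}, ∀ (θ : Cardinal.{u}) (hW : W ∈ HSet θ) (N : HSet θ),
      IsClosedSet ⟨W, hW⟩ N → ∀ i j, e i ∈ N.1 → e j ∈ N.1 → ∀ z ∈ F (e i) (e j), z ∈ N.1 := by
  -- Enumerating each F x y turns the operation into a single-valued one with a natural number as
  -- additional argument. The code of that number is in N automatically.
  choose f hf using fun x y => Set.countable_iff_exists_subset_range.1 (hF x y)
  refine ⟨ZFSet.range fun x : I × I × ℕ => ZFSet.pair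
    (ZFSet.pair (ZFSet.pair (e x.1) (e x.2.1)) (natCode x.2.2)) (f (e x.1) (e x.2.1) x.2.2),
    fun θ hW N hN i j hi hj z hz => ?_⟩
  obtain ⟨n, rfl⟩ := hf _ _ hz
  have hmem : ∀ {x : ZFSet.{u}}, x ∈ N.1 → x ∈ HSet θ := fun hx => HSet.mem_of_mem N.2 hx
  have hpair : ∀ {x y : ZFSet.{u}}, x ∈ N.1 → y ∈ N.1 → ZFSet.pair x y ∈ N.1 :=
    fun hx hy => hN.2.1 ⟨_, hmem hx⟩ hx ⟨_, hmem hy⟩ hy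
  have hkey := hpair (hpair hi hj) (hN.natCode_mem n)
  have hgraph : ZFSet.pair (ZFSet.pair (ZFSet.pair (e i) (e j)) (natCode n)) (f (e i) (e j) n) ∈
      ZFSet.range fun x : I × I × ℕ => ZFSet.pair
        (ZFSet.pair (ZFSet.pair (e x.1) (e x.2.1)) (natCode x.2.2)) (f (e x.1) (e x.2.1) x.2.2) :=
    ZFSet.mem_range.2 ⟨(i, j, n), rfl⟩
  obtain ⟨w, hwN, hw⟩ := hN.2.2 ⟨_, hmem hkey⟩ hkey
    ⟨⟨_, HSet.snd_mem_of_pair_mem (HSet.mem_of_mem hW hgraph)⟩, hgraph⟩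
  -- The value is unique even if e is not injective, because f depends on the codes e i and e j
  -- only.
  obtain ⟨⟨i', j', n'⟩, h⟩ := ZFSet.mem_range.1 hw
  obtain ⟨h1, h2⟩ := ZFSet.pair_inj.1 h
  obtain ⟨h3, h4⟩ := ZFSet.pair_inj.1 h1
  obtain ⟨h5, h6⟩ := ZFSet.pair_inj.1 h3
  obtain rfl := natCode_injective h4
  have h7 : f (e i) (e j) n' = w.1 := by
    rw [← h2, ← show e i' = e i from h5, ← show e j' = e j from h6]
  rwa [h7]

/-- The operations themselves need not be in M. A code W for them controls the forcing in H(θ),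
elementarity yields a controlling W' in M, and W' is applied to the set N of all elements of M,
which is countable and so belongs to H(θ). -/
theorem isProperForcing_of_closure_operations {P : Type u} [Preorder P] (C₁ : P → P → Set P)
    (C₂ : P → Set P → Set P) (hC₁ : ∀ p p₁, (C₁ p p₁).Countable)
    (hC₂ : ∀ p D, (C₂ p D).Countable)
    (H : ∀ (S : Set P) (𝒟 : Set (Set P)), S.Countable → 𝒟.Countable →
      (∀ p ∈ S, ∀ p₁ ∈ S, C₁ p p₁ ⊆ S) → (∀ p ∈ S, ∀ D ∈ 𝒟, C₂ p D ⊆ S) →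
      ∀ p ∈ S, ∃ q ≤ p, ∀ D ∈ 𝒟, ForcingDense D → ∃ s ∈ D, s ∈ S ∧ q ≤ s) :
    IsProperForcing P := by
  intro c hc
  let e : P ⊕ Set P → ZFSet.{u} := Sum.elim c (codeSet c)
  -- The code of a condition may coincide with the code of a set of conditions, so F collects the
  -- values of both operations.
  let F : ZFSet.{u} → ZFSet.{u} → Set ZFSet.{u} := fun x y =>
    {z | ∃ p p₁, c p = x ∧ c p₁ = y ∧ z ∈ c '' C₁ p p₁} ∪
      {z | ∃ p D, c p = x ∧ codeSet c D = y ∧ z ∈ c '' C₂ p D}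
  have hF : ∀ x y, (F x y).Countable := by
    intro x y
    refine Set.Countable.union ?_ ?_
    · by_cases h : ∃ p p₁, c p = x ∧ c p₁ = y
      · obtain ⟨p, p₁, rfl, rfl⟩ := h
        refine ((hC₁ p p₁).image c).mono ?_
        rintro z ⟨p', p₁', h1, h2, hz⟩
        rwa [hc h1, hc h2] at hz
      · refine Set.countable_empty.mono ?_
        rintro z ⟨p', p₁', h1, h2, -⟩
        exact h ⟨p', p₁', h1, h2⟩
    · by_cases h : ∃ p D, c p = x ∧ codeSet c D = y
      · obtain ⟨p, D, rfl, rfl⟩ := h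
        refine ((hC₂ p D).image c).mono ?_
        rintro z ⟨p', D', h1, h2, hz⟩
        rwa [hc h1, codeSet_injective hc h2] at hz
      · refine Set.countable_empty.mono ?_
        rintro z ⟨p', D', h1, h2, -⟩
        exact h ⟨p', D', h1, h2⟩
  obtain ⟨W, hW⟩ := exists_graph_closed e F hF
  obtain ⟨θ₁, hθ₁⟩ := HSet.exists_forall_mem W
  -- Beyond this bound H(θ) contains W, and θ is uncountable, so countable subsets of H(θ) are
  -- elements.
  refine ⟨max θ₁ ℵ₁, fun θ hle hθ M hM hPM p hp => ?_⟩
  have hWθ : W ∈ HSet θ := hθ₁ θ ((le_max_left _ _).trans hle)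
  have hℵ : ℵ₀ < θ := Cardinal.aleph0_lt_aleph_one.trans_le ((le_max_right _ _).trans hle)
  obtain ⟨Q, hQM, E, hEM, hQ, hE⟩ := exists_mem_elementarySubstructure_eq_pair hθ hℵ hPM
  have hmemQ : ∀ x, x ∈ Q.1 ↔ ∃ p, c p = x := fun x => by
    rw [hQ, codeSet, ZFSet.mem_range]
    exact ⟨fun ⟨p, h⟩ => ⟨p.1, h⟩, fun ⟨p, h⟩ => ⟨⟨p, trivial⟩, h⟩⟩
  have hmemE : ∀ x y, ZFSet.pair x y ∈ E.1 ↔ ∃ p q, p ≤ q ∧ c p = x ∧ c q = y := fun x y => by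
    rw [hE, ZFSet.mem_range]
    constructor
    · rintro ⟨pq, h⟩
      exact ⟨_, _, pq.2, ZFSet.pair_inj.1 h⟩
    · rintro ⟨p, q, hpq, rfl, rfl⟩
      exact ⟨⟨(p, q), hpq⟩, rfl⟩
  have hmemE' : ∀ p q, ZFSet.pair (c p) (c q) ∈ E.1 ↔ p ≤ q := fun p q => by
    rw [hmemE]
    constructor
    · rintro ⟨p', q', h, h1, h2⟩
      rwa [← hc h1, ← hc h2]
    · exact fun h => ⟨p, q, h, rfl, rfl⟩
  have hcθ : ∀ p, c p ∈ HSet θ := fun p => HSet.mem_of_mem Q.2 ((hmemQ _).2 ⟨p, rfl⟩)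
  -- Closure of N under W is closure of its conditions under `C₁` and `C₂`, for all sets of
  -- conditions coded in N.
  have hcontrol : IsControlling ⟨W, hWθ⟩ Q E := by
    intro N hN hNc x hxN hxQ
    have hNc' := countable_of_isCountableSet hθ hℵ hNc
    obtain ⟨p, hpx⟩ := (hmemQ _).1 hxQ
    have hclosed := hW θ hWθ N hN
    obtain ⟨q, hqp, hq⟩ := H {p | c p ∈ N.1} {D | codeSet c D ∈ N.1}
      (hNc'.preimage_of_injOn hc.injOn) (hNc'.preimage_of_injOn (codeSet_injective hc).injOn)
      (fun p hp p₁ hp₁ z hz => hclosed (Sum.inl p) (Sum.inl p₁) hp hp₁ _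
        (Or.inl ⟨p, p₁, rfl, rfl, z, hz, rfl⟩))
      (fun p hp D hD z hz => hclosed (Sum.inl p) (Sum.inr D) hp hD _
        (Or.inr ⟨p, D, rfl, rfl, z, hz, rfl⟩)) p (by rwa [Set.mem_ofPred_eq, hpx])
    refine ⟨⟨c q, hcθ q⟩, by rw [← hpx]; exact (hmemE' q p).2 hqp, fun D hDN hDQ hD => ?_⟩
    have hDcode : codeSet c {p | c p ∈ D.1} = D.1 := by
      refine ZFSet.ext fun z => ?_
      rw [codeSet, ZFSet.mem_range]
      constructor
      · rintro ⟨p, rfl⟩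
        exact p.2
      · intro hz
        obtain ⟨p, rfl⟩ := (hmemQ z).1 (hDQ ⟨z, HSet.mem_of_mem D.2 hz⟩ hz)
        exact ⟨⟨p, hz⟩, rfl⟩
    obtain ⟨s, hsD, hsN, hqs⟩ := hq {p | c p ∈ D.1} (by rwa [Set.mem_ofPred_eq, hDcode]) (by
      intro p
      obtain ⟨y, hyD, hy⟩ := hD ⟨c p, hcθ p⟩ ((hmemQ _).2 ⟨p, rfl⟩)
      obtain ⟨r, p', hrp, hr, hp'⟩ := (hmemE _ _).1 hy
      exact ⟨r, by rwa [Set.mem_ofPred_eq, hr], hc hp' ▸ hrp⟩)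
    exact ⟨⟨c s, hcθ s⟩, hsD, hsN, (hmemE' q s).2 hqs⟩
  -- Elementarity replaces W by a controlling set in M, with Q and E as parameters.
  obtain ⟨W', hW'M, hW'⟩ := IsFirstOrder.exists_mem M 0
    (r := fun v W => IsControlling W (v 1) (v 2)) (IsFirstOrder.isControlling hθ hℵ)
    (fun _ _ => rfl) (v := fun i => if i = 1 then Q else E)
    (fun i => by split_ifs; exacts [hQM, hEM]) ⟨⟨W, hWθ⟩, hcontrol⟩
  obtain ⟨N, hN, hNM⟩ := HSet.exists_mem_of_countable hθ hℵ hM (by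
    rintro _ ⟨x, -, rfl⟩
    exact x.2)
  have hNM' : {y | y ∈ N} = elemsOf M := Set.ext hNM
  obtain ⟨q, hqp, hq⟩ := hW' ⟨N, hN⟩
    (isClosedSet_of_elementarySubstructure hθ hℵ (fun x => (hNM _).trans (mem_elemsOf M)) hW'M)
    (isCountableSet_of_countable hθ hℵ ⟨_, (hNM _).2 hp⟩ (hNM' ▸ hM)) ⟨c p, hcθ p⟩ ((hNM _).2 hp)
    ((hmemQ _).2 ⟨p, rfl⟩)
  obtain ⟨q', p', hqp', hq', hp'⟩ := (hmemE _ _).1 hqp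
  refine ⟨q', hc hp' ▸ hqp', fun D hD hDM r hr => ?_⟩
  obtain ⟨s, hsD, hsN, hqs⟩ := hq ⟨codeSet c D, HSet.mem_of_mem hN ((hNM _).2 hDM)⟩
    ((hNM _).2 hDM) (by
      intro x hx
      obtain ⟨p, hp⟩ := ZFSet.mem_range.1 hx
      exact (hmemQ _).2 ⟨p.1, hp⟩) (by
      intro x hx
      obtain ⟨p, hp⟩ := (hmemQ _).1 hx
      obtain ⟨d, hd, hdp⟩ := hD p
      exact ⟨⟨c d, hcθ d⟩, ZFSet.mem_range.2 ⟨⟨d, hd⟩, rfl⟩, by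
        rw [← hp]
        exact (hmemE' d p).2 hdp⟩)
  obtain ⟨s', hs'⟩ := ZFSet.mem_range.1 hsD
  obtain ⟨q'', s'', hle', hq'', hs''⟩ := (hmemE _ _).1 hqs
  have h1 : q'' = q' := hc (hq''.trans hq'.symm)
  have h2 : s'' = s'.1 := hc (hs''.trans hs'.symm)
  -- The condition q' is below s', which is more than predensity demands, so r itself is a common
  -- extension.
  refine ⟨s'.1, s'.2, by rw [hs']; exact (hNM _).1 hsN, r, le_rfl, hr.trans ?_⟩
  rw [← h1, ← h2]
  exact hle'

theorem theorem3p8 {R : Type u} [PartialOrder R] [IsTree R]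
    (hSuslin : IsSuslin R) (hNormal : IsNormalTree R) (hFree : IsFreeTree R)
    (κ : Ordinal.{u}) (hκ : κ ≠ 0) :
    IsProperForcing (CountableSupportProduct κ.ToType R) ∧
      IsCountablyDistributive (CountableSupportProduct κ.ToType R) := by
  have : Nonempty κ.ToType := Ordinal.nonempty_toType_iff.2 hκ
  obtain ⟨C₁, C₂, hC₁, hC₂, H⟩ :=
    CountableSupportProduct.exists_closure_operations (ι := κ.ToType) hSuslin hNormal hFree
  exact ⟨isProperForcing_of_closure_operations C₁ C₂ hC₁ hC₂ H,
    CountableSupportProduct.isCountablyDistributive hSuslin hNormal hFree⟩
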